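/- Let $d\in\mathbb N$, $0<\alpha<d$. Measures are non-negative Borel measures on $\mathbb R^d$; cubes $Q$ have sides parallel to the axes and side length $\ell(Q)>0$. For a locally finite measure $\mu$ put $$I_\alpha\mu(x)=\frac1{\gamma(\alpha)}\int_{\mathbb R^d}\frac{d\mu(y)}{|x-y|^{d-\alpha}},\quad \gamma(\alpha)=\frac{\pi^{d/2}2^\alpha\Gamma(\alpha/2)}{\Gamma((d-\alpha)/2)},\qquad \mathcal M_\alpha\mu(x)=\sup_{Q\ni x}\frac{\mu(Q)}{\ell(Q)^{d-\alpha}},$$ and for $\beta>0$ and $E\subseteq\mathbb R^d$ let $$\mathcal H^\beta_\infty(E)=\inf\Big\{\sum_{i=1}^\infty\omega_\beta r_i^\beta:\ E\subseteq\bigcup_{i=1}^\infty B(x_i,r_i)\Big\},\qquad \omega_\beta=\frac{\pi^{\beta/2}}{\Gamma(\beta/2+1)}.$$ A dyadic grid is a countable family $\mathcal D$ of half-open cubes, with side lengths in $\{2^k:k\in\mathbb Z\}$, any two of which are disjoint or nested, such that for every $k\in\mathbb Z$ the cubes in $\mathcal D$ of side length $2^k$ partition $\mathbb R^d$; put $I^{\mathcal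 D}_\alpha\mu=\sum_{Q\in\mathcal D}\mu(Q)\,\ell(Q)^{\alpha-d}\chi_Q$. For $i\in\{0,\frac13\}^d$ let $\mathcal D^i=\{2^{-k}([0,1)^d+m+(-1)^k i): k\in\mathbb Z,\ m\in\mathbb Z^d\}$. There are constants $\gamma_1,\gamma_2>1$ depending only on $d,\alpha$ such that, for all locally finite measures $\mu$ on $\mathbb R^d$, all dyadic grids $\mathcal D$ and all $x\in\mathbb R^d$, $$\text{(1)}\quad I_\alpha\mu(x)\le\gamma_1\sum_{i\in\{0,\frac13\}^d}I^{\mathcal D^i}_\alpha\mu(x),\qquad\qquad \text{(2)}\quad I^{\mathcal D}_\alpha\mu(x)\le\gamma_2\, I_\alpha\mu(x).$$ Moreover, for every $\beta\in(d-\alpha,d]$ there are constants $C,c>0$ depending only on $d,\alpha,\beta$ such that, for all constants $\gamma_1,\gamma_2>1$ for which (1) and (2) hold (for all $\mu$, $\mathcal D$, $x$ as above), every locally finite measure $\mu$ on $\mathbb R^d$, all $\lambda>0$ and all $0<\varepsilon<1$, $$\mathcal H^\beta_\infty\big(\{x: I_\alpha\mu(x)>2^{d+1}\gamma_1\lambda,\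 \mathcal M_\alpha\mu(x)\le\varepsilon\lambda\}\big)\le C e^{-c/\varepsilon}\,\mathcal H^\beta_\infty\big(\{x: I_\alpha\mu(x)>\gamma_2^{-1}\lambda\}\big).$$ -/

import Mathlib

open MeasureTheory
open scoped ENNReal NNReal

noncomputable section

/-- The Hausdorff content of dimension `β` of a subset of `ℝ^d`:
`inf { ∑ ω_β r_i^β : E ⊆ ⋃ B(x_i, r_i) }` with `ω_β = π^(β/2) / Γ(β/2 + 1)`, over countable
covers by balls. Radius `0` (the empty ball, which costs nothing as `β > 0`) allows finite covers. -/
def hausdorffContent {d : ℕ} (β : ℝ) (E : Set (EuclideanSpace ℝ (Fin d))) : ℝ≥0∞ :=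
  ⨅ (x : ℕ → EuclideanSpace ℝ (Fin d)) (r : ℕ → ℝ≥0)
    (_ : E ⊆ ⋃ i, Metric.ball (x i) (r i : ℝ)),
    ∑' i, ENNReal.ofReal (Real.pi ^ (β / 2) / Real.Gamma (β / 2 + 1) * (r i : ℝ) ^ β)

/-- The normalization `γ(α) = π^(d/2) 2^α Γ(α/2) / Γ((d-α)/2)` of the Riesz potential. -/
def rieszConst (d : ℕ) (α : ℝ) : ℝ :=
  Real.pi ^ ((d : ℝ) / 2) * 2 ^ α * Real.Gamma (α / 2) / Real.Gamma (((d : ℝ) - α) / 2)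

/-- The Riesz potential `I_α μ (x) = γ(α)⁻¹ ∫ |x - y|^(α - d) dμ(y)`, with values in `[0, ∞]`.
The kernel is `∞` at `y = x`, since `(0 : ℝ≥0∞) ^ s = ∞` for `s < 0`. -/
def rieszPotential {d : ℕ} (α : ℝ) (μ : Measure (EuclideanSpace ℝ (Fin d)))
    (x : EuclideanSpace ℝ (Fin d)) : ℝ≥0∞ :=
  (ENNReal.ofReal (rieszConst d α))⁻¹ * ∫⁻ y, edist x y ^ (α - (d : ℝ)) ∂μ

/-- A (half-open) cube in `ℝ^d` with sides parallel to the coordinate axes. -/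
structure AxisCube (d : ℕ) where
  corner : EuclideanSpace ℝ (Fin d)
  side : ℝ
  side_pos : 0 < side

/-- The underlying set `∏_j [corner_j, corner_j + side)` of a cube. -/
def AxisCube.toSet {d : ℕ} (Q : AxisCube d) : Set (EuclideanSpace ℝ (Fin d)) :=
  {x | ∀ j, Q.corner j ≤ x j ∧ x j < Q.corner j + Q.side}

/-- The quotient `μ(Q) / ℓ(Q)^(d-α)`. -/
def fractionalAverage {d : ℕ} (α : ℝ) (μ : Measure (EuclideanSpace ℝ (Fin d)))
    (Q : AxisCube d) : ℝ≥0∞ :=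
  μ Q.toSet / ENNReal.ofReal (Q.side ^ ((d : ℝ) - α))

/-- The fractional maximal function `M_α μ (x) = sup_{Q ∋ x} μ(Q) / ℓ(Q)^(d-α)`, over all cubes
containing `x`. (Open or closed cubes give the same supremum.) -/
def fractionalMaximal {d : ℕ} (α : ℝ) (μ : Measure (EuclideanSpace ℝ (Fin d)))
    (x : EuclideanSpace ℝ (Fin d)) : ℝ≥0∞ :=
  ⨆ (Q : AxisCube d) (_ : x ∈ Q.toSet), fractionalAverage α μ Q

/-- Dyadic grids: countable families of cubes whose side lengths are powers of two, any two of
which are nested or disjoint, and whose members of side `2^k` partition `ℝ^d` for every `k ∈ ℤ`. -/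
structure IsDyadicGrid {d : ℕ} (D : Set (AxisCube d)) : Prop where
  countable : D.Countable
  side_eq : ∀ Q ∈ D, ∃ k : ℤ, Q.side = (2 : ℝ) ^ k
  nested : ∀ Q ∈ D, ∀ P ∈ D, Q.toSet ∩ P.toSet = ∅ ∨
    Q.toSet ∩ P.toSet = P.toSet ∨ Q.toSet ∩ P.toSet = Q.toSet
  partition : ∀ (k : ℤ) (x : EuclideanSpace ℝ (Fin d)),
    ∃! Q : AxisCube d, Q ∈ D ∧ Q.side = (2 : ℝ) ^ k ∧ x ∈ Q.toSet

/-- The dyadic Riesz potential `I_α^D μ = ∑_{Q ∈ D} μ(Q) / ℓ(Q)^(d-α) χ_Q`. -/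
def dyadicRieszPotential {d : ℕ} (D : Set (AxisCube d)) (α : ℝ)
    (μ : Measure (EuclideanSpace ℝ (Fin d))) (x : EuclideanSpace ℝ (Fin d)) : ℝ≥0∞ :=
  ∑' Q : D, Q.1.toSet.indicator (fun _ => fractionalAverage α μ Q.1) x

/-- The grid `D^i = { 2^(-k) ([0,1)^d + m + (-1)^k i) : k ∈ ℤ, m ∈ ℤ^d }`. -/
def shiftedGrid {d : ℕ} (i : Fin d → ℝ) : Set (AxisCube d) :=
  {Q | ∃ (k : ℤ) (m : Fin d → ℤ), Q.side = (2 : ℝ) ^ (-k) ∧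
    ∀ j, Q.corner j = (2 : ℝ) ^ (-k) * ((m j : ℝ) + (-1 : ℝ) ^ k * i j)}

/-- The index set `{0, 1/3}^d`. -/
def thirdShifts (d : ℕ) : Finset (Fin d → ℝ) :=
  Fintype.piFinset fun _ => ({0, 1 / 3} : Finset ℝ)

/-- `γ₁` is an admissible constant in the pointwise bound
`I_α μ ≤ γ₁ ∑_{i ∈ {0,1/3}^d} I_α^{D^i} μ` for all locally finite measures `μ` on `ℝ^d`. -/
def DominatesRiesz (d : ℕ) (α γ₁ : ℝ) : Prop :=
  ∀ (μ : Measure (EuclideanSpace ℝ (Fin d))) [IsLocallyFiniteMeasure μ]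
    (x : EuclideanSpace ℝ (Fin d)),
    rieszPotential α μ x ≤
      ENNReal.ofReal γ₁ * ∑ i ∈ thirdShifts d, dyadicRieszPotential (shiftedGrid i) α μ x

/-- `γ₂` is an admissible constant in the pointwise bound `I_α^D μ ≤ γ₂ I_α μ` for all dyadic
grids `D` and all locally finite measures `μ` on `ℝ^d`. -/
def DominatesDyadicRiesz (d : ℕ) (α γ₂ : ℝ) : Prop :=
  ∀ (D : Set (AxisCube d)), IsDyadicGrid D →
    ∀ (μ : Measure (EuclideanSpace ℝ (Fin d))) [IsLocallyFiniteMeasure μ]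
      (x : EuclideanSpace ℝ (Fin d)),
      dyadicRieszPotential D α μ x ≤ ENNReal.ofReal γ₂ * rieszPotential α μ x

end

/-! Both pointwise bounds reduce to point masses, since both potentials are integrals in `y` of
their values for `Measure.dirac y`. For (1), the one-third trick (`exists_mem_shiftedGrid`) puts `x`
and `y` in a common cube of some shifted grid of side comparable to their distance, and this single
cube already pays for the kernel. For (2), a cube containing both points has side at least `dist x y
/ √d`, so the levels sum to a geometric series.

The content inequality is proved grid by grid. By (1), a point with potential above `2 ^ (d + 1) *
γ₁ * lam` has dyadic potential above `2 * lam` in one of the `2 ^ d` grids; by (2), the dyadic level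
set at `lam` lies in that of the Riesz potential at `γ₂⁻¹ * lam`.

Within a grid there are two ingredients. `hausdorffContent_localPotential_le`: where the fractional
averages are at most `t`, each increment of the localized potential by `decayStep δ * t`, with `δ =
β - (d - α) > 0`, halves the bound on the content. The increments come from stopping at cubes whose
average exceeds `2 t` times a power of their relative side; the exponent `δ` makes the skipped
levels geometrically summable and turns the mass bound into a bound for the sum of sides to the
power `β`.

`hausdorffContent_goodLambda_of_cover`: the content is not additive, so the larger level set is not
decomposed directly. An arbitrary dyadic cover of it is fixed, and each relevant point is placed
either in a large covering cube or in a maximal cube covered by smaller ones. As `β ≤ d`, the latter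
cubes cost no more than the cover. The local decay is then applied on each of these cubes. -/

/-! ### Powers of two and geometric sums. -/

/-- The power `2 ^ s` in `[0, ∞]`. -/
noncomputable def twoPow (s : ℝ) : ℝ≥0∞ := 2 ^ s

lemma twoPow_add (s t : ℝ) : twoPow (s + t) = twoPow s * twoPow t :=
  ENNReal.rpow_add _ _ two_ne_zero ENNReal.ofNat_ne_top

lemma twoPow_mono {s t : ℝ} (h : s ≤ t) : twoPow s ≤ twoPow t :=
  ENNReal.rpow_le_rpow_of_exponent_le (by norm_num) h

lemma twoPow_lt_one {s : ℝ} (h : s < 0) : twoPow s < 1 :=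
  ENNReal.rpow_lt_one_of_one_lt_of_neg (by norm_num) h

lemma twoPow_mul (s t : ℝ) : twoPow (s * t) = twoPow s ^ t := ENNReal.rpow_mul _ _ _

lemma twoPow_neg (s : ℝ) : twoPow (-s) = (twoPow s)⁻¹ := ENNReal.rpow_neg _ _

lemma ofReal_two_rpow (s : ℝ) : ENNReal.ofReal ((2 : ℝ) ^ s) = twoPow s := by
  rw [twoPow, ← ENNReal.ofReal_rpow_of_pos two_pos]; simp

lemma ofReal_two_zpow_rpow (k : ℤ) (s : ℝ) :
    ENNReal.ofReal (((2 : ℝ) ^ k) ^ s) = twoPow (k * s) := by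
  rw [← Real.rpow_intCast, ← Real.rpow_mul two_pos.le, ofReal_two_rpow]

lemma ofReal_two_zpow (k : ℤ) : ENNReal.ofReal ((2 : ℝ) ^ k) = twoPow k := by
  rw [← Real.rpow_intCast, ofReal_two_rpow]

lemma tsum_twoPow_nat {s : ℝ} (n : ℕ → ℝ) (hn : ∀ i, n i = -(s * i)) :
    ∑' i, twoPow (n i) = (1 - twoPow (-s))⁻¹ := by
  rw [← ENNReal.tsum_geometric]
  refine tsum_congr fun i => ?_
  rw [hn, ← ENNReal.rpow_natCast, ← twoPow_mul]
  ring_nf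

/-- Geometric sum over the integers up to `k`. -/
lemma tsum_ite_le_twoPow (s : ℝ) (k : ℤ) :
    ∑' j : ℤ, (if j ≤ k then twoPow (s * (j - k)) else 0) = (1 - twoPow (-s))⁻¹ := by
  have hinj : Function.Injective fun n : ℕ => k - n := fun a b h => by simpa using h
  rw [← hinj.tsum_eq]
  · simp only [sub_le_self_iff, Nat.cast_nonneg, if_true]
    exact tsum_twoPow_nat _ fun i => by push_cast; ring
  · intro j hj
    have : j ≤ k := by by_contra h; simp [h] at hj
    exact ⟨(k - j).toNat, by simp only; omega⟩

/-- Geometric sum over the integers from `k` on. -/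
lemma tsum_ite_ge_twoPow (s : ℝ) (k : ℤ) :
    ∑' j : ℤ, (if k ≤ j then twoPow (-s * j) else 0) =
      twoPow (-s * k) * (1 - twoPow (-s))⁻¹ := by
  have hinj : Function.Injective fun n : ℕ => k + n := fun a b h => by simpa using h
  rw [← hinj.tsum_eq, ← tsum_twoPow_nat (s := s) (fun i : ℕ => -(s * i)) fun i => rfl,
    ← ENNReal.tsum_mul_left]
  · refine tsum_congr fun i => ?_
    rw [if_pos (by omega), ← twoPow_add]
    push_cast; ring_nf
  · intro j hj
    have : k ≤ j := by by_contra h; simp [h] at hj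
    exact ⟨(j - k).toNat, by simp only; omega⟩

lemma one_sub_twoPow_inv_ne_top {s : ℝ} (hs : 0 < s) : (1 - twoPow (-s))⁻¹ ≠ ⊤ := by
  rw [Ne, ENNReal.inv_eq_top, tsub_eq_zero_iff_le, not_le]
  exact twoPow_lt_one (by linarith)

/-! ### Volume and diameter of cubes. -/

namespace AxisCube

variable {d : ℕ}

lemma measurableSet_toSet (Q : AxisCube d) : MeasurableSet Q.toSet := by
  simp only [toSet, Set.ofPred_forall]
  refine MeasurableSet.iInter fun j => ?_
  have : Measurable fun x : EuclideanSpace ℝ (Fin d) => x j := by fun_prop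
  exact this measurableSet_Ico

lemma volume_toSet (Q : AxisCube d) : volume Q.toSet = ENNReal.ofReal Q.side ^ d := by
  have h : Q.toSet = (MeasurableEquiv.toLp 2 (Fin d → ℝ)).symm ⁻¹'
      (Set.univ.pi fun j => Set.Ico (Q.corner j) (Q.corner j + Q.side)) := by
    ext x; simp [toSet]
  rw [h, (EuclideanSpace.volume_preserving_symm_measurableEquiv_toLp (Fin d)).measure_preimage
    (MeasurableSet.univ_pi fun j => measurableSet_Ico).nullMeasurableSet, Real.volume_pi_Ico]
  simp

lemma corner_mem (Q : AxisCube d) : Q.corner ∈ Q.toSet := fun j => ⟨le_rfl, by linarith [Q.side_pos]⟩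

lemma side_le_of_subset (hd : 0 < d) {P Q : AxisCube d} (h : P.toSet ⊆ Q.toSet) :
    P.side ≤ Q.side := by
  have := measure_mono (μ := volume) h
  rw [volume_toSet, volume_toSet, ENNReal.pow_le_pow_left_iff hd.ne',
    ENNReal.ofReal_le_ofReal_iff Q.side_pos.le] at this
  exact this

lemma dist_le_of_mem (Q : AxisCube d) {x y : EuclideanSpace ℝ (Fin d)} (hx : x ∈ Q.toSet)
    (hy : y ∈ Q.toSet) : dist x y ≤ √d * Q.side := by
  rw [EuclideanSpace.dist_eq]
  have : ∑ j, dist (x j) (y j) ^ 2 ≤ d * Q.side ^ 2 := by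
    calc ∑ j, dist (x j) (y j) ^ 2 ≤ ∑ _j : Fin d, Q.side ^ 2 := by
          refine Finset.sum_le_sum fun j _ => ?_
          have := hx j; have := hy j
          refine pow_le_pow_left₀ dist_nonneg ?_ 2
          rw [Real.dist_eq, abs_le]; constructor <;> linarith
      _ = _ := by simp
  calc _ ≤ √(d * Q.side ^ 2) := Real.sqrt_le_sqrt this
    _ = _ := by rw [Real.sqrt_mul (by positivity), Real.sqrt_sq Q.side_pos.le]

end AxisCube

/-! ### Dyadic grids and their maximal cubes. -/

namespace IsDyadicGrid

variable {d : ℕ} {D : Set (AxisCube d)} (hD : IsDyadicGrid D)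

/-- The cube of side `2 ^ k` of a dyadic grid that contains `x`. -/
noncomputable def cube (k : ℤ) (x : EuclideanSpace ℝ (Fin d)) : AxisCube d :=
  (hD.partition k x).choose

lemma cube_mem (k : ℤ) (x : EuclideanSpace ℝ (Fin d)) : hD.cube k x ∈ D :=
  (hD.partition k x).choose_spec.1.1

lemma side_cube (k : ℤ) (x : EuclideanSpace ℝ (Fin d)) : (hD.cube k x).side = 2 ^ k :=
  (hD.partition k x).choose_spec.1.2.1

lemma mem_cube (k : ℤ) (x : EuclideanSpace ℝ (Fin d)) : x ∈ (hD.cube k x).toSet :=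
  (hD.partition k x).choose_spec.1.2.2

lemma eq_cube {k : ℤ} {x : EuclideanSpace ℝ (Fin d)} {Q : AxisCube d} (hQ : Q ∈ D)
    (hs : Q.side = 2 ^ k) (hx : x ∈ Q.toSet) : Q = hD.cube k x :=
  (hD.partition k x).choose_spec.2 Q ⟨hQ, hs, hx⟩

lemma cube_eq_of_mem {k : ℤ} {x y : EuclideanSpace ℝ (Fin d)} (h : y ∈ (hD.cube k x).toSet) :
    hD.cube k y = hD.cube k x :=
  (hD.eq_cube (hD.cube_mem k x) (hD.side_cube k x) h).symm

lemma level_eq_of_cube_eq {k l : ℤ} {x y : EuclideanSpace ℝ (Fin d)}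
    (h : hD.cube k x = hD.cube l y) : k = l := by
  have : (2 : ℝ) ^ k = 2 ^ l := by rw [← hD.side_cube k x, ← hD.side_cube l y, h]
  exact zpow_right_injective₀ (by norm_num) (by norm_num) this

/-- Both cubes contain `x`, so they are nested; comparing volumes excludes the wrong inclusion
unless the levels agree. -/
lemma cube_subset (hd : 0 < d) {k l : ℤ} (hkl : k ≤ l) (x : EuclideanSpace ℝ (Fin d)) :
    (hD.cube k x).toSet ⊆ (hD.cube l x).toSet := by
  rcases hD.nested _ (hD.cube_mem k x) _ (hD.cube_mem l x) with h | h | h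
  · have : x ∈ (∅ : Set (EuclideanSpace ℝ (Fin d))) := h ▸ ⟨hD.mem_cube k x, hD.mem_cube l x⟩
    exact this.elim
  · have h1 := AxisCube.side_le_of_subset hd (Set.inter_eq_right.1 h)
    rw [side_cube, side_cube] at h1
    have : l ≤ k := (zpow_le_zpow_iff_right₀ (by norm_num)).1 h1
    rw [le_antisymm hkl this]
  · exact Set.inter_eq_left.1 h

lemma cube_eq_of_mem_of_le (hd : 0 < d) {k l : ℤ} (hkl : k ≤ l) {x y : EuclideanSpace ℝ (Fin d)}
    (h : y ∈ (hD.cube k x).toSet) : hD.cube l y = hD.cube l x :=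
  hD.cube_eq_of_mem (hD.cube_subset hd hkl x h)

lemma fractionalAverage_cube (α : ℝ) (μ : Measure (EuclideanSpace ℝ (Fin d))) (k : ℤ)
    (x : EuclideanSpace ℝ (Fin d)) :
    fractionalAverage α μ (hD.cube k x) = μ (hD.cube k x).toSet * twoPow (k * (α - d)) := by
  rw [fractionalAverage, side_cube, ofReal_two_zpow_rpow, div_eq_mul_inv, ← twoPow_neg]
  ring_nf

/-- Exactly one cube of each level contains `x`, so the sum over the grid becomes a sum over levels.
-/
lemma dyadicRieszPotential_eq (α : ℝ) (μ : Measure (EuclideanSpace ℝ (Fin d)))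
    (x : EuclideanSpace ℝ (Fin d)) :
    dyadicRieszPotential D α μ x = ∑' k : ℤ, fractionalAverage α μ (hD.cube k x) := by
  have hinj : Function.Injective fun k : ℤ => (⟨hD.cube k x, hD.cube_mem k x⟩ : D) :=
    fun k l h => hD.level_eq_of_cube_eq (congrArg Subtype.val h)
  rw [dyadicRieszPotential, ← hinj.tsum_eq]
  · exact tsum_congr fun k => Set.indicator_of_mem (hD.mem_cube k x) _
  · intro Q hQ
    have hx : x ∈ Q.1.toSet := by by_contra h; simp [h] at hQ
    obtain ⟨k, hk⟩ := hD.side_eq Q.1 Q.2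
    exact ⟨k, Subtype.ext (hD.eq_cube Q.2 hk hx).symm⟩

/-- The cubes of a dyadic grid that are maximal for a property of the cube of side `2 ^ k`
containing a point. -/
def maximalCubes (T : ℤ → EuclideanSpace ℝ (Fin d) → Prop) : Set (AxisCube d) :=
  {Q | ∃ k x, Q = hD.cube k x ∧ T k x ∧ ∀ j, k < j → ¬ T j x}

lemma maximalCubes_subset (T : ℤ → EuclideanSpace ℝ (Fin d) → Prop) : hD.maximalCubes T ⊆ D := by
  rintro _ ⟨k, x, rfl, -⟩
  exact hD.cube_mem k x

/-- If two maximal cubes met, the larger would also be a `T`-cube at the points of the smaller,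
against maximality; so the levels agree and the cubes coincide. `hT` says that `T` depends only on
the cube. -/
lemma disjoint_maximalCubes (hd : 0 < d) {T : ℤ → EuclideanSpace ℝ (Fin d) → Prop}
    (hT : ∀ k x y, y ∈ (hD.cube k x).toSet → T k x → T k y) :
    Pairwise (Function.onFun Disjoint fun Q : hD.maximalCubes T => Q.1.toSet) := by
  have key : ∀ (k l : ℤ) (x y z : EuclideanSpace ℝ (Fin d)), T l y → (∀ j, k < j → ¬ T j x) →
      z ∈ (hD.cube k x).toSet → z ∈ (hD.cube l y).toSet → l ≤ k := by
    intro k l x y z hl hk hx hy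
    by_contra! h
    refine hk l h (hT l z x ?_ (hT l y z hy hl))
    rw [hD.cube_eq_of_mem_of_le hd h.le hx]
    exact hD.mem_cube l x
  rintro ⟨_, k, x, rfl, h1, h2⟩ ⟨_, l, y, rfl, h3, h4⟩ hne
  refine Set.disjoint_left.2 fun z hx hy => hne ?_
  obtain rfl : k = l := le_antisymm (key l k y x z h1 h4 hy hx) (key k l x y z h3 h2 hx hy)
  exact Subtype.ext ((hD.cube_eq_of_mem hx).symm.trans (hD.cube_eq_of_mem hy))

/-- The packing estimate, used both for `μ` in the stopping-time step and for `weightMeasure` in the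
covering step. -/
lemma tsum_measure_maximalCubes_le (hd : 0 < d) {T : ℤ → EuclideanSpace ℝ (Fin d) → Prop}
    (hT : ∀ k x y, y ∈ (hD.cube k x).toSet → T k x → T k y)
    (ν : Measure (EuclideanSpace ℝ (Fin d))) {E : Set (EuclideanSpace ℝ (Fin d))}
    {S : Set (AxisCube d)} (hS : S ⊆ hD.maximalCubes T) (hE : ∀ Q ∈ S, Q.toSet ⊆ E) :
    ∑' Q : S, ν Q.1.toSet ≤ ν E := by
  refine (tsum_meas_le_meas_iUnion_of_disjoint ν (fun Q : S => Q.1.measurableSet_toSet) ?_).trans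
    (measure_mono (Set.iUnion_subset fun Q => hE _ Q.2))
  intro P Q hne
  exact hD.disjoint_maximalCubes hd hT (i := ⟨P.1, hS P.2⟩) (j := ⟨Q.1, hS Q.2⟩)
    fun h => hne (Subtype.ext (congrArg (fun R : hD.maximalCubes T => R.1) h))

end IsDyadicGrid

/-! ### Hausdorff content: covers, subadditivity, cubes. -/

section hausdorffContent

variable {d : ℕ}

lemma hausdorffContent_mono (β : ℝ) {E F : Set (EuclideanSpace ℝ (Fin d))} (h : E ⊆ F) :
    hausdorffContent β E ≤ hausdorffContent β F :=
  le_iInf₂ fun x r => le_iInf fun hF => iInf₂_le_of_le x r (iInf_le _ (h.trans hF))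

/-- The cost of a ball in the definition of the Hausdorff content. -/
noncomputable def ballCost (β : ℝ) (r : ℝ≥0) : ℝ≥0∞ :=
  ENNReal.ofReal (Real.pi ^ (β / 2) / Real.Gamma (β / 2 + 1) * (r : ℝ) ^ β)

lemma unitBallConst_pos {β : ℝ} (hβ : 0 < β) :
    0 < Real.pi ^ (β / 2) / Real.Gamma (β / 2 + 1) :=
  div_pos (Real.rpow_pos_of_pos Real.pi_pos _) (Real.Gamma_pos_of_pos (by linarith))

lemma ballCost_zero {β : ℝ} (hβ : 0 < β) : ballCost β 0 = 0 := by
  simp [ballCost, Real.zero_rpow hβ.ne']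

/-- Covers may have any countable index type: unused indices in `ℕ` receive radius `0`, which is
free because `β > 0`. -/
lemma hausdorffContent_le_tsum {β : ℝ} (hβ : 0 < β) {κ : Type*} [Countable κ]
    {E : Set (EuclideanSpace ℝ (Fin d))} (x : κ → EuclideanSpace ℝ (Fin d)) (r : κ → ℝ≥0)
    (h : E ⊆ ⋃ i, Metric.ball (x i) (r i)) : hausdorffContent β E ≤ ∑' i, ballCost β (r i) := by
  obtain ⟨f, hf⟩ := exists_injective_nat κ
  refine iInf₂_le_of_le (Function.extend f x 0) (Function.extend f r 0) (iInf_le_of_le ?_ ?_)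
  · refine h.trans (Set.iUnion_subset fun i => ?_)
    refine Set.Subset.trans ?_ (Set.subset_iUnion _ (f i))
    rw [hf.extend_apply, hf.extend_apply]
  · refine le_of_eq ?_
    change ∑' n, ballCost β (Function.extend f r 0 n) = _
    rw [← tsum_extend_zero hf]
    refine tsum_congr fun n => ?_
    by_cases hn : ∃ i, f i = n
    · obtain ⟨i, rfl⟩ := hn
      rw [hf.extend_apply, hf.extend_apply]
    · rw [Function.extend_apply' _ _ _ hn, Function.extend_apply' _ _ _ hn]
      exact ballCost_zero hβ

lemma hausdorffContent_iUnion_le {β : ℝ} (hβ : 0 < β) {ι : Type*} [Countable ι]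
    (E : ι → Set (EuclideanSpace ℝ (Fin d))) :
    hausdorffContent β (⋃ i, E i) ≤ ∑' i, hausdorffContent β (E i) := by
  refine ENNReal.le_of_forall_pos_le_add fun ε hε hfin => ?_
  obtain ⟨ε', hε', hsum⟩ := ENNReal.exists_pos_sum_of_countable
    (ENNReal.coe_pos.2 hε).ne' ι
  have hcov : ∀ i, ∃ (x : ℕ → EuclideanSpace ℝ (Fin d)) (r : ℕ → ℝ≥0),
      (E i ⊆ ⋃ n, Metric.ball (x n) (r n)) ∧
        ∑' n, ballCost β (r n) < hausdorffContent β (E i) + ε' i := by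
    intro i
    have : hausdorffContent β (E i) < hausdorffContent β (E i) + ε' i :=
      ENNReal.lt_add_right (ENNReal.ne_top_of_tsum_ne_top hfin.ne i)
        (ENNReal.coe_pos.2 (hε' i)).ne'
    conv_lhs at this => rw [hausdorffContent]
    simp only [iInf_lt_iff] at this
    obtain ⟨x, r, h1, h2⟩ := this
    exact ⟨x, r, h1, h2⟩
  choose x r hE hr using hcov
  calc hausdorffContent β (⋃ i, E i)
      ≤ ∑' p : ι × ℕ, ballCost β (r p.1 p.2) := by
        refine hausdorffContent_le_tsum hβ (fun p => x p.1 p.2) _ ?_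
        refine Set.iUnion_subset fun i z hz => ?_
        obtain ⟨n, hn⟩ := Set.mem_iUnion.1 (hE i hz)
        exact Set.mem_iUnion.2 ⟨(i, n), hn⟩
    _ = ∑' i, ∑' n, ballCost β (r i n) := ENNReal.tsum_prod'
    _ ≤ ∑' i, (hausdorffContent β (E i) + ε' i) := ENNReal.tsum_le_tsum fun i => (hr i).le
    _ = ∑' i, hausdorffContent β (E i) + ∑' i, (ε' i : ℝ≥0∞) := ENNReal.tsum_add
    _ ≤ _ := by gcongr

lemma hausdorffContent_union_le {β : ℝ} (hβ : 0 < β) (E F : Set (EuclideanSpace ℝ (Fin d))) :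
    hausdorffContent β (E ∪ F) ≤ hausdorffContent β E + hausdorffContent β F := by
  have := hausdorffContent_iUnion_le hβ fun b : Bool => cond b E F
  rwa [← Set.union_eq_iUnion, tsum_bool, add_comm] at this

lemma hausdorffContent_empty {β : ℝ} (hβ : 0 < β) :
    hausdorffContent β (∅ : Set (EuclideanSpace ℝ (Fin d))) = 0 := by
  have := hausdorffContent_iUnion_le (d := d) hβ fun e : Empty => e.elim
  simpa using this

/-- The constant in the bound of the content of a cube by its side length. -/
noncomputable def cubeContentConst (d : ℕ) (β : ℝ) : ℝ :=
  Real.pi ^ (β / 2) / Real.Gamma (β / 2 + 1) * (√d + 1) ^ β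

lemma cubeContentConst_pos (d : ℕ) {β : ℝ} (hβ : 0 < β) : 0 < cubeContentConst d β :=
  mul_pos (unitBallConst_pos hβ) (Real.rpow_pos_of_pos (by positivity) _)

lemma hausdorffContent_cube_le {β : ℝ} (hβ : 0 < β) (Q : AxisCube d) :
    hausdorffContent β Q.toSet ≤
      ENNReal.ofReal (cubeContentConst d β) * ENNReal.ofReal (Q.side ^ β) := by
  have hpos : 0 < √d + 1 := by positivity
  have hr := mul_nonneg hpos.le Q.side_pos.le
  refine (hausdorffContent_le_tsum hβ (fun _ : Unit => Q.corner)
    (fun _ => ((√d + 1) * Q.side).toNNReal) fun x hx => ?_).trans ?_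
  · refine Set.mem_iUnion.2 ⟨(), ?_⟩
    have := Q.dist_le_of_mem hx Q.corner_mem
    rw [Metric.mem_ball, Real.coe_toNNReal _ hr]
    linarith [Q.side_pos]
  · rw [tsum_fintype]
    simp only [Finset.univ_unique, Finset.sum_singleton, ballCost]
    rw [Real.coe_toNNReal _ hr, Real.mul_rpow hpos.le Q.side_pos.le, ← mul_assoc,
      ← cubeContentConst, ENNReal.ofReal_mul (cubeContentConst_pos d hβ).le]

end hausdorffContent

/-! ### Exponential decay for localized potentials. -/

/-- Stopping time step constant of the exponential decay. -/
noncomputable def decayStep (δ : ℝ) : ℝ≥0∞ := 2 * (1 - twoPow (-δ))⁻¹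

lemma decayStep_ne_top {δ : ℝ} (hδ : 0 < δ) : decayStep δ ≠ ⊤ :=
  ENNReal.mul_ne_top ENNReal.ofNat_ne_top (one_sub_twoPow_inv_ne_top hδ)

lemma decayStep_ne_zero (δ : ℝ) : decayStep δ ≠ 0 := by
  refine mul_ne_zero two_ne_zero (ENNReal.inv_ne_zero.2 ?_)
  exact ne_top_of_le_ne_top ENNReal.one_ne_top tsub_le_self

namespace IsDyadicGrid

variable {d : ℕ} {D : Set (AxisCube d)} (hD : IsDyadicGrid D)

/-- The part of the dyadic Riesz potential that comes from the cubes of side at most `2 ^ k`. -/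
noncomputable def localPotential (α : ℝ) (μ : Measure (EuclideanSpace ℝ (Fin d))) (k : ℤ)
    (x : EuclideanSpace ℝ (Fin d)) : ℝ≥0∞ :=
  ∑' j : ℤ, if j ≤ k then fractionalAverage α μ (hD.cube j x) else 0

/-- The bound `b` is summed over all levels up to `k`, not only those above `p`, so that the first
term does not depend on the stopping level `p`. -/
lemma localPotential_le_add {α : ℝ} {μ : Measure (EuclideanSpace ℝ (Fin d))} {p k : ℤ}
    {x : EuclideanSpace ℝ (Fin d)} {b : ℤ → ℝ≥0∞}
    (h : ∀ j, p < j → j ≤ k → fractionalAverage α μ (hD.cube j x) ≤ b j) :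
    hD.localPotential α μ k x ≤
      (∑' j : ℤ, if j ≤ k then b j else 0) + hD.localPotential α μ p x := by
  rw [localPotential, localPotential, ← ENNReal.tsum_add]
  refine ENNReal.tsum_le_tsum fun j => ?_
  by_cases hk : j ≤ k <;> by_cases hp : j ≤ p
  · simp [hk, hp]
  · simpa [hk, hp] using h j (not_le.1 hp) hk
  · simp [hk]
  · simp [hk]

/-- Exponential decay of the content of the level sets of a localized dyadic potential, where the
fractional averages are bounded. -/
lemma hausdorffContent_localPotential_le (hd : 0 < d) {α β : ℝ} (hβ0 : 0 < β)
    (hβ : (d : ℝ) - α < β) (μ : Measure (EuclideanSpace ℝ (Fin d)))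
    {F : Set (EuclideanSpace ℝ (Fin d))} {t : ℝ≥0∞} (ht0 : t ≠ 0) (ht : t ≠ ⊤)
    (hF : ∀ x ∈ F, ∀ k, fractionalAverage α μ (hD.cube k x) ≤ t) (m : ℕ) (k : ℤ)
    (x₀ : EuclideanSpace ℝ (Fin d)) :
    hausdorffContent β {x | x ∈ F ∧ x ∈ (hD.cube k x₀).toSet ∧
        m * (decayStep (β - (d - α)) * t) < hD.localPotential α μ k x} ≤
      ENNReal.ofReal (cubeContentConst d β) * 2⁻¹ ^ m * twoPow (k * β) := by
  induction m generalizing k x₀ with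
  | zero =>
    refine (hausdorffContent_mono β fun x hx => hx.2.1).trans
      ((hausdorffContent_cube_le hβ0 _).trans ?_)
    rw [side_cube, ofReal_two_zpow_rpow, pow_zero, mul_one]
  | succ m ih =>
    set δ := β - (d - α) with hδ
    have hδ0 : 0 < δ := by linarith
    -- In the nonempty case `x₁` is a point of `F` in the cube, which is what bounds the mass of the
    -- whole cube in `hbig`.
    rcases Set.eq_empty_or_nonempty {x | x ∈ F ∧ x ∈ (hD.cube k x₀).toSet ∧
        (m + 1 : ℕ) * (decayStep δ * t) < hD.localPotential α μ k x} with h | ⟨x₁, hx₁F, hx₁, -⟩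
    · rw [h, hausdorffContent_empty hβ0]
      exact zero_le
    -- The factor `2` yields the halving. The decay `2 ^ (δ (j - k))` makes the thresholds of all
    -- levels `j ≤ k` sum to `decayStep δ * t`.
    let T : ℤ → EuclideanSpace ℝ (Fin d) → Prop := fun j x =>
      j ≤ k ∧ 2 * t * twoPow (δ * (j - k)) < fractionalAverage α μ (hD.cube j x) ∧
        x ∈ (hD.cube k x₀).toSet
    have hT : ∀ j x y, y ∈ (hD.cube j x).toSet → T j x → T j y := by
      rintro j x y hy ⟨h1, h2, h3⟩
      refine ⟨h1, by rwa [hD.cube_eq_of_mem hy], ?_⟩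
      rw [← hD.cube_eq_of_mem h3]
      exact hD.cube_subset hd h1 x hy
    have : Countable (hD.maximalCubes T) :=
      (hD.countable.mono (hD.maximalCubes_subset T)).to_subtype
    have hex : ∀ P : hD.maximalCubes T, ∃ k x, P.1 = hD.cube k x ∧ T k x := fun P => by
      obtain ⟨k, x, h1, h2, -⟩ := P.2
      exact ⟨k, x, h1, h2⟩
    choose l z hP hTP using hex
    have hcover : {x | x ∈ F ∧ x ∈ (hD.cube k x₀).toSet ∧
        (m + 1 : ℕ) * (decayStep δ * t) < hD.localPotential α μ k x} ⊆
        ⋃ P : hD.maximalCubes T, {x | x ∈ F ∧ x ∈ (hD.cube (l P) (z P)).toSet ∧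
          m * (decayStep δ * t) < hD.localPotential α μ (l P) x} := by
      rintro x ⟨hxF, hxQ, hx⟩
      -- Levels strictly between the stopping level and the top use up at most one increment
      -- `decayStep δ * t`; the stopping cube itself stays in the potential at level `p`.
      have hstep : ∀ p, (∀ j, p < j → j ≤ k → ¬ T j x) →
          m * (decayStep δ * t) < hD.localPotential α μ p x := by
        intro p hp
        have h1 := hD.localPotential_le_add (α := α) (μ := μ) (p := p) (k := k) (x := x)
          (b := fun j => 2 * t * twoPow (δ * (j - k))) fun j h1 h2 => by
            by_contra! h3
            exact hp j h1 h2 ⟨h2, h3, hxQ⟩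
        have h2 : (∑' j : ℤ, if j ≤ k then 2 * t * twoPow (δ * (j - k)) else 0) =
            decayStep δ * t := by
          rw [decayStep, ← tsum_ite_le_twoPow δ k, mul_right_comm, ← ENNReal.tsum_mul_left]
          simp only [mul_ite, mul_zero]
        rw [h2] at h1
        have h3 := hx.trans_le h1
        rw [Nat.cast_add, Nat.cast_one, add_one_mul, add_comm] at h3
        exact (ENNReal.add_lt_add_iff_left (ENNReal.mul_ne_top (decayStep_ne_top hδ0) ht)).1 h3
      have hexT : ∃ j, T j x := by
        by_contra! hno
        have h1 := hD.localPotential_le_add (α := α) (μ := μ) (p := k) (k := k) (x := x)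
          (b := 0) fun j h1 h2 => absurd h2 (not_le.2 h1)
        have hall : ∀ j, j ≤ k →
            fractionalAverage α μ (hD.cube j x) ≤ 2 * t * twoPow (δ * (j - k)) := by
          intro j hj
          by_contra! h3
          exact hno j ⟨hj, h3, hxQ⟩
        have h2 : hD.localPotential α μ k x ≤ decayStep δ * t := by
          rw [decayStep, ← tsum_ite_le_twoPow δ k, mul_right_comm, ← ENNReal.tsum_mul_left]
          refine ENNReal.tsum_le_tsum fun j => ?_
          by_cases hj : j ≤ k
          · simpa [hj] using hall j hj
          · simp [hj]
        refine absurd (hx.trans_le h2) (not_lt.2 ?_)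
        exact le_mul_of_one_le_left zero_le (by simp)
      obtain ⟨p, hp, hmax⟩ := Int.exists_greatest_of_bdd ⟨k, fun j hj => hj.1⟩ hexT
      have hPmem : hD.cube p x ∈ hD.maximalCubes T :=
        ⟨p, x, rfl, hp, fun j hj hTj => (hmax j hTj).not_gt hj⟩
      have heq := hP ⟨_, hPmem⟩
      have hl := hD.level_eq_of_cube_eq heq
      refine Set.mem_iUnion.2 ⟨⟨_, hPmem⟩, hxF, heq ▸ hD.mem_cube p x, ?_⟩
      rw [← hl]
      exact hstep p fun j hj _ hTj => (hmax j hTj).not_gt hj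
    -- The stopping inequality multiplied by `2 ^ (kδ + l(d - α))`; since `δ + (d - α) = β`, the
    -- left side becomes the side of `P` to the power `β`.
    have hsmall : ∀ P : hD.maximalCubes T,
        2 * t * twoPow (l P * β) ≤ twoPow (k * δ) * μ P.1.toSet := by
      intro P
      have h := (hTP P).2.1.le
      rw [fractionalAverage_cube, ← hP P] at h
      calc 2 * t * twoPow (l P * β)
          = 2 * t * twoPow (δ * (l P - k)) * twoPow (k * δ + l P * (d - α)) := by
            rw [mul_assoc (2 * t), ← twoPow_add, hδ]; ring_nf
        _ ≤ μ P.1.toSet * twoPow (l P * (α - d)) * twoPow (k * δ + l P * (d - α)) := by gcongr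
        _ = μ P.1.toSet * twoPow (k * δ) := by
            rw [mul_assoc, ← twoPow_add]; ring_nf
        _ = _ := mul_comm _ _
    have hbig : twoPow (k * δ) * μ (hD.cube k x₀).toSet ≤ t * twoPow (k * β) := by
      have h := hF x₁ hx₁F k
      rw [fractionalAverage_cube, hD.cube_eq_of_mem hx₁] at h
      calc twoPow (k * δ) * μ (hD.cube k x₀).toSet
          = μ (hD.cube k x₀).toSet * twoPow (k * (α - d)) * twoPow (k * β) := by
            rw [mul_assoc, ← twoPow_add, mul_comm, hδ]; ring_nf
        _ ≤ _ := by gcongr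
    -- Summing `hsmall` over disjoint cubes and using `hbig` gives `2 t` on the left against `t` on
    -- the right.
    have hsum : ∑' P : hD.maximalCubes T, twoPow (l P * β) ≤ 2⁻¹ * twoPow (k * β) := by
      have h1 : 2 * t * ∑' P : hD.maximalCubes T, twoPow (l P * β) ≤ t * twoPow (k * β) := by
        rw [← ENNReal.tsum_mul_left]
        refine (ENNReal.tsum_le_tsum hsmall).trans ?_
        rw [ENNReal.tsum_mul_left]
        refine le_trans ?_ hbig
        gcongr
        refine hD.tsum_measure_maximalCubes_le hd hT μ subset_rfl ?_
        rintro _ ⟨j, x, rfl, ⟨h1, -, h3⟩, -⟩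
        rw [← hD.cube_eq_of_mem h3]
        exact hD.cube_subset hd h1 x
      rw [mul_comm 2 t, mul_assoc, ENNReal.mul_le_mul_iff_right ht0 ht] at h1
      rw [← ENNReal.div_eq_inv_mul, ENNReal.le_div_iff_mul_le (by simp) (by simp), mul_comm]
      exact h1
    calc _ ≤ _ := hausdorffContent_mono β hcover
      _ ≤ _ := hausdorffContent_iUnion_le hβ0 _
      _ ≤ ∑' P : hD.maximalCubes T,
          ENNReal.ofReal (cubeContentConst d β) * 2⁻¹ ^ m * twoPow (l P * β) :=
        ENNReal.tsum_le_tsum fun P => ih _ _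
      _ ≤ ENNReal.ofReal (cubeContentConst d β) * 2⁻¹ ^ m * (2⁻¹ * twoPow (k * β)) := by
        rw [ENNReal.tsum_mul_left]; gcongr
      _ = _ := by rw [pow_succ]; ring

end IsDyadicGrid

/-! ### Dyadic covers and the dyadic good-`λ` inequality. -/

namespace IsDyadicGrid

variable {d : ℕ} {D : Set (AxisCube d)} (hD : IsDyadicGrid D)

/-- A ball is covered by `3 ^ d` cubes of a dyadic grid of side larger than its radius. -/
lemma ball_subset_iUnion_cube (x : EuclideanSpace ℝ (Fin d)) {r : ℝ} {k : ℤ} (hr : r ≤ 2 ^ k) :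
    Metric.ball x r ⊆ ⋃ v : Fin d → Fin 3,
      (hD.cube k (WithLp.toLp 2 fun j => x j + 2 ^ k * ((v j : ℕ) - 1 : ℝ))).toSet := by
  intro y hy
  set Q := hD.cube k y with hQ
  have hs : Q.side = 2 ^ k := hD.side_cube k y
  have hyQ : y ∈ Q.toSet := hD.mem_cube k y
  -- In each coordinate `x j` is within `2 ^ k` of a point of the interval of `Q`, so moving it by
  -- `-2 ^ k`, `0` or `2 ^ k` lands inside.
  have hv : ∀ j, ∃ v : Fin 3, Q.corner j ≤ x j + 2 ^ k * ((v : ℕ) - 1 : ℝ) ∧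
      x j + 2 ^ k * ((v : ℕ) - 1 : ℝ) < Q.corner j + Q.side := by
    intro j
    have h1 : |y j - x j| < 2 ^ k := by
      have := PiLp.norm_apply_le (y - x) j
      rw [← dist_eq_norm] at this
      exact (this.trans_lt (Metric.mem_ball.1 hy)).trans_le hr
    rw [abs_lt] at h1
    have h2 := hyQ j
    rw [hs] at h2 ⊢
    rcases lt_or_ge (x j) (Q.corner j) with h | h
    · exact ⟨2, by norm_num; constructor <;> linarith⟩
    · rcases lt_or_ge (x j) (Q.corner j + 2 ^ k) with h' | h'
      · exact ⟨1, by norm_num; constructor <;> linarith⟩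
      · exact ⟨0, by norm_num; constructor <;> linarith⟩
  choose v hv using hv
  refine Set.mem_iUnion.2 ⟨v, ?_⟩
  have hmem : (WithLp.toLp 2 fun j => x j + 2 ^ k * ((v j : ℕ) - 1 : ℝ)) ∈ Q.toSet := hv
  rw [← hD.eq_cube (hD.cube_mem k y) hs hmem]
  exact hyQ

/-- The measure with mass `2 ^ (n i * β)` at the point `z i`. -/
noncomputable def weightMeasure {ι : Type*} (β : ℝ) (n : ι → ℤ)
    (z : ι → EuclideanSpace ℝ (Fin d)) : Measure (EuclideanSpace ℝ (Fin d)) :=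
  Measure.sum fun i => twoPow (n i * β) • Measure.dirac (z i)

lemma weightMeasure_univ {ι : Type*} (β : ℝ) (n : ι → ℤ) (z : ι → EuclideanSpace ℝ (Fin d)) :
    weightMeasure β n z Set.univ = ∑' i, twoPow (n i * β) := by
  simp [weightMeasure, Measure.sum_apply]

/-- If a cube is covered by dyadic cubes that are no larger, then its side to the power `β ≤ d` is
at most the sum of those of the covering cubes. -/
lemma twoPow_le_weightMeasure (hd : 0 < d) {β : ℝ} (hβd : β ≤ d) {ι : Type*} [Countable ι]
    {n : ι → ℤ} {z : ι → EuclideanSpace ℝ (Fin d)} {p : ℤ} {x : EuclideanSpace ℝ (Fin d)}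
    (hcov : (hD.cube p x).toSet ⊆ ⋃ i, (hD.cube (n i) (z i)).toSet)
    (hn : ∀ i, ∀ y ∈ (hD.cube p x).toSet, y ∈ (hD.cube (n i) (z i)).toSet → n i ≤ p) :
    twoPow (p * β) ≤ weightMeasure β n z (hD.cube p x).toSet := by
  classical
  have hvol : ∀ (k : ℤ) (y : EuclideanSpace ℝ (Fin d)),
      volume (hD.cube k y).toSet = twoPow (k * d) := fun k y => by
    rw [AxisCube.volume_toSet, side_cube, ofReal_two_zpow, ← ENNReal.rpow_natCast, ← twoPow_mul]
  -- Compare volumes. A covering cube that meets the given cube is no larger, hence contained in it,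
  -- and so its base point `z i` lies there too.
  have h1 : twoPow (p * d) ≤ ∑' i,
      if z i ∈ (hD.cube p x).toSet then twoPow (n i * d) else 0 := by
    rw [← hvol p x]
    calc volume (hD.cube p x).toSet ≤ volume (⋃ i, if z i ∈ (hD.cube p x).toSet then
          (hD.cube (n i) (z i)).toSet else ∅) := by
          refine measure_mono fun y hy => ?_
          obtain ⟨i, hi⟩ := Set.mem_iUnion.1 (hcov hy)
          refine Set.mem_iUnion.2 ⟨i, ?_⟩
          rw [if_pos]
          · exact hi
          · rw [← hD.cube_eq_of_mem hy]
            refine hD.cube_subset hd (hn i y hy hi) y ?_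
            rw [hD.cube_eq_of_mem hi]
            exact hD.mem_cube _ _
      _ ≤ _ := measure_iUnion_le _
      _ ≤ _ := ENNReal.tsum_le_tsum fun i => by
          split_ifs
          · exact (hvol _ _).le
          · simp
  calc twoPow (p * β) = twoPow (p * (β - d)) * twoPow (p * d) := by
        rw [← twoPow_add]; ring_nf
    _ ≤ twoPow (p * (β - d)) * ∑' i,
        if z i ∈ (hD.cube p x).toSet then twoPow (n i * d) else 0 := by gcongr
    _ = ∑' i, if z i ∈ (hD.cube p x).toSet then
        twoPow (p * (β - d)) * twoPow (n i * d) else 0 := by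
        rw [← ENNReal.tsum_mul_left]; simp only [mul_ite, mul_zero]
    -- Here `β ≤ d` enters: `p (β - d) ≤ n i (β - d)` because `n i ≤ p`.
    _ ≤ ∑' i, if z i ∈ (hD.cube p x).toSet then twoPow (n i * β) else 0 := by
        refine ENNReal.tsum_le_tsum fun i => ?_
        split_ifs with hi
        · rw [← twoPow_add]
          have : (n i : ℝ) ≤ p := by exact_mod_cast hn i _ hi (hD.mem_cube _ _)
          exact twoPow_mono (by nlinarith)
        · simp
    _ = _ := by
        rw [weightMeasure, Measure.sum_apply _ (AxisCube.measurableSet_toSet _)]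
        refine tsum_congr fun i => ?_
        rw [Measure.smul_apply, Measure.dirac_apply' _ (AxisCube.measurableSet_toSet _)]
        by_cases hi : z i ∈ (hD.cube p x).toSet <;> simp [hi]

/-- The part of the dyadic Riesz potential that comes from the cubes of side at least `2 ^ k`. -/
noncomputable def upperPotential (α : ℝ) (μ : Measure (EuclideanSpace ℝ (Fin d))) (k : ℤ)
    (x : EuclideanSpace ℝ (Fin d)) : ℝ≥0∞ :=
  ∑' j : ℤ, if k ≤ j then fractionalAverage α μ (hD.cube j x) else 0

/-- Makes "upper potential above `lam`" a property of cubes, so that maximal cubes can be formed. -/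
lemma upperPotential_congr (hd : 0 < d) (α : ℝ) (μ : Measure (EuclideanSpace ℝ (Fin d))) {k : ℤ}
    {x y : EuclideanSpace ℝ (Fin d)} (h : y ∈ (hD.cube k x).toSet) :
    hD.upperPotential α μ k y = hD.upperPotential α μ k x := by
  refine tsum_congr fun j => ?_
  split_ifs with hj
  · rw [hD.cube_eq_of_mem_of_le hd hj h]
  · rfl

lemma localPotential_add_upperPotential (α : ℝ) (μ : Measure (EuclideanSpace ℝ (Fin d))) (k : ℤ)
    (x : EuclideanSpace ℝ (Fin d)) :
    hD.localPotential α μ k x + hD.upperPotential α μ (k + 1) x =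
      dyadicRieszPotential D α μ x := by
  rw [hD.dyadicRieszPotential_eq, localPotential, upperPotential, ← ENNReal.tsum_add]
  refine tsum_congr fun j => ?_
  by_cases hj : j ≤ k
  · simp [hj, not_lt.2 hj]
  · simp [hj, Int.add_one_le_iff.2 (not_le.1 hj)]

lemma upperPotential_le (α : ℝ) (μ : Measure (EuclideanSpace ℝ (Fin d))) (k : ℤ)
    (x : EuclideanSpace ℝ (Fin d)) :
    hD.upperPotential α μ k x ≤ dyadicRieszPotential D α μ x := by
  rw [hD.dyadicRieszPotential_eq]
  exact ENNReal.tsum_le_tsum fun j => by split_ifs <;> simp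

lemma exists_lt_upperPotential {α : ℝ} {μ : Measure (EuclideanSpace ℝ (Fin d))}
    {x : EuclideanSpace ℝ (Fin d)} {lam : ℝ≥0∞} (h : lam < dyadicRieszPotential D α μ x) :
    ∃ k, lam < hD.upperPotential α μ k x := by
  rw [hD.dyadicRieszPotential_eq, ENNReal.tsum_eq_iSup_sum, lt_iSup_iff] at h
  obtain ⟨s, hs⟩ := h
  obtain ⟨k, hk⟩ := s.bddBelow
  refine ⟨k, hs.trans_le ?_⟩
  calc _ = ∑ j ∈ s, if k ≤ j then fractionalAverage α μ (hD.cube j x) else 0 :=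
        Finset.sum_congr rfl fun j hj => by rw [if_pos (hk hj)]
    _ ≤ _ := ENNReal.sum_le_tsum _

lemma exists_lt_twoPow {β : ℝ} (hβ : 0 < β) {W : ℝ≥0∞} (hW : W ≠ ⊤) :
    ∃ k : ℤ, W < twoPow (k * β) := by
  obtain ⟨n, hn⟩ := pow_unbounded_of_one_lt W.toReal (Real.one_lt_rpow one_lt_two hβ)
  refine ⟨n, ?_⟩
  rw [← ofReal_two_rpow, ← ENNReal.ofReal_toReal hW]
  refine (ENNReal.ofReal_lt_ofReal_iff (by positivity)).2 (hn.trans_eq ?_)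
  rw [← Real.rpow_natCast, ← Real.rpow_mul two_pos.le, mul_comm]
  norm_cast

/-- The good-`λ` inequality for the dyadic potential, relative to a cover of the larger level set by
dyadic cubes. -/
lemma hausdorffContent_goodLambda_of_cover (hd : 0 < d) {α β : ℝ} (hβ0 : 0 < β)
    (hβ : (d : ℝ) - α < β) (hβd : β ≤ d) (μ : Measure (EuclideanSpace ℝ (Fin d)))
    {F : Set (EuclideanSpace ℝ (Fin d))} {t lam : ℝ≥0∞} (ht0 : t ≠ 0) (ht : t ≠ ⊤)
    (hF : ∀ x ∈ F, ∀ k, fractionalAverage α μ (hD.cube k x) ≤ t) (hlam : lam ≠ ⊤) {m : ℕ}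
    (hm : m * (decayStep (β - (d - α)) * t) ≤ lam) {ι : Type*} [Countable ι] (n : ι → ℤ)
    (z : ι → EuclideanSpace ℝ (Fin d))
    (hcov : {x | lam < dyadicRieszPotential D α μ x} ⊆ ⋃ i, (hD.cube (n i) (z i)).toSet)
    (hW : ∑' i, twoPow (n i * β) ≠ ⊤) :
    hausdorffContent β {x | x ∈ F ∧ 2 * lam < dyadicRieszPotential D α μ x} ≤
      2 * (ENNReal.ofReal (cubeContentConst d β) * 2⁻¹ ^ m * ∑' i, twoPow (n i * β)) := by
  let T : ℤ → EuclideanSpace ℝ (Fin d) → Prop := fun k x => lam < hD.upperPotential α μ k x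
  have hT : ∀ k x y, y ∈ (hD.cube k x).toSet → T k x → T k y := fun k x y hy h => by
    simpa only [T, hD.upperPotential_congr hd α μ hy] using h
  have hTcov : ∀ k x, T k x → (hD.cube k x).toSet ⊆ ⋃ i, (hD.cube (n i) (z i)).toSet :=
    fun k x h y hy => hcov ((hT k x y hy h).trans_le (hD.upperPotential_le _ _ _ _))
  obtain ⟨K, hK⟩ := exists_lt_twoPow hβ0 hW
  -- A cube of level `k > K` costs more than the whole cover, so every covering cube is smaller; the
  -- comparison of sides then contradicts the choice of `K`.
  have hTbdd : ∀ k x, T k x → k ≤ K := by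
    intro k x h
    by_contra! hk
    have hk' : (K : ℝ) ≤ k := by exact_mod_cast hk.le
    have hlt : ∑' i, twoPow (n i * β) < twoPow (k * β) :=
      hK.trans_le (twoPow_mono (by gcongr))
    refine hlt.not_ge ((hD.twoPow_le_weightMeasure hd hβd (hTcov k x h) ?_).trans
      ((measure_mono (Set.subset_univ _)).trans (weightMeasure_univ β n z).le))
    intro i y _ _
    by_contra! hi
    have hi' : (k : ℝ) ≤ n i := by exact_mod_cast hi.le
    exact (hlt.trans_le (twoPow_mono (by gcongr))).not_ge (ENNReal.le_tsum i)
  -- Only maximal cubes that the cover pays for are kept. The bound ranges over all representations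
  -- `P = hD.cube k x`, but the level is determined by `P`.
  let S : Set (AxisCube d) := {P | P ∈ hD.maximalCubes T ∧
    ∀ k x, P = hD.cube k x → twoPow (k * β) ≤ weightMeasure β n z P.toSet}
  have hSsub : S ⊆ hD.maximalCubes T := fun P hP => hP.1
  have : Countable S := (hD.countable.mono (hSsub.trans (hD.maximalCubes_subset T))).to_subtype
  have hex : ∀ P : S, ∃ k x, P.1 = hD.cube k x := fun P => by
    obtain ⟨k, x, h, -⟩ := P.2.1
    exact ⟨k, x, h⟩
  choose l ζ hP using hex
  let E : ℤ → EuclideanSpace ℝ (Fin d) → Set (EuclideanSpace ℝ (Fin d)) := fun k y =>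
    {x | x ∈ F ∧ x ∈ (hD.cube k y).toSet ∧
      m * (decayStep (β - (d - α)) * t) < hD.localPotential α μ k x}
  have hE : ∀ k y, hausdorffContent β (E k y) ≤
      ENNReal.ofReal (cubeContentConst d β) * 2⁻¹ ^ m * twoPow (k * β) := fun k y =>
    hD.hausdorffContent_localPotential_le hd hβ0 hβ μ ht0 ht hF m k y
  have hcover : {x | x ∈ F ∧ 2 * lam < dyadicRieszPotential D α μ x} ⊆
      (⋃ i, E (n i) (z i)) ∪ ⋃ P : S, E (l P) (ζ P) := by
    rintro x ⟨hxF, hx⟩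
    have hxΩ : lam < dyadicRieszPotential D α μ x :=
      (le_mul_of_one_le_left zero_le one_le_two).trans_lt hx
    obtain ⟨p, hp, hmax⟩ := Int.exists_greatest_of_bdd ⟨K, fun k hk => hTbdd k x hk⟩
      (hD.exists_lt_upperPotential hxΩ)
    -- Levels above `p` contribute at most `lam` out of more than `2 * lam`, so more than `lam`
    -- remains in the local part.
    have hlocal : ∀ k, p ≤ k → m * (decayStep (β - (d - α)) * t) < hD.localPotential α μ k x := by
      intro k hk
      have h1 : hD.upperPotential α μ (k + 1) x ≤ lam := by
        by_contra! h
        have := hmax _ h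
        omega
      have h2 := hx
      rw [← hD.localPotential_add_upperPotential α μ k x, two_mul] at h2
      exact hm.trans_lt ((ENNReal.add_lt_add_iff_right hlam).1 (h2.trans_le (by gcongr)))
    -- A covering cube of level at least `p` around `x` is used as it stands. If there is none,
    -- every covering cube that meets the maximal cube has level below `p`, as a larger one would
    -- contain `x`.
    by_cases hi : ∃ i, p ≤ n i ∧ x ∈ (hD.cube (n i) (z i)).toSet
    · obtain ⟨i, hi, hxi⟩ := hi
      exact Or.inl (Set.mem_iUnion.2 ⟨i, hxF, hxi, hlocal _ hi⟩)
    · push Not at hi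
      have hS : hD.cube p x ∈ S := by
        refine ⟨⟨p, x, rfl, hp, fun j hj hTj => (hmax j hTj).not_gt hj⟩, fun k y hky => ?_⟩
        rw [← hD.level_eq_of_cube_eq hky]
        refine hD.twoPow_le_weightMeasure hd hβd (hTcov p x hp) fun i y hy hyi => ?_
        by_contra! hlt
        refine hi i hlt.le ?_
        rw [← hD.cube_eq_of_mem hyi, hD.cube_eq_of_mem_of_le hd hlt.le hy]
        exact hD.mem_cube _ _
      have heq := hP ⟨_, hS⟩
      refine Or.inr (Set.mem_iUnion.2 ⟨⟨_, hS⟩, hxF, heq ▸ hD.mem_cube p x, ?_⟩)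
      rw [← hD.level_eq_of_cube_eq heq]
      exact hlocal p le_rfl
  refine (hausdorffContent_mono β hcover).trans ((hausdorffContent_union_le hβ0 _ _).trans ?_)
  rw [two_mul]
  refine add_le_add ?_ ?_
  · refine (hausdorffContent_iUnion_le hβ0 _).trans ?_
    rw [← ENNReal.tsum_mul_left]
    exact ENNReal.tsum_le_tsum fun i => hE _ _
  · refine (hausdorffContent_iUnion_le hβ0 _).trans
      ((ENNReal.tsum_le_tsum fun P => hE _ _).trans ?_)
    rw [ENNReal.tsum_mul_left]
    gcongr
    calc ∑' P : S, twoPow (l P * β) ≤ ∑' P : S, weightMeasure β n z P.1.toSet :=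
          ENNReal.tsum_le_tsum fun P => P.2.2 _ _ (hP P)
      _ ≤ weightMeasure β n z Set.univ :=
          hD.tsum_measure_maximalCubes_le hd hT _ hSsub fun Q _ => Set.subset_univ _
      _ = _ := weightMeasure_univ β n z

/-- The constant that compares covers by dyadic cubes with covers by balls. -/
noncomputable def dyadicCoverConst (d : ℕ) (β : ℝ) : ℝ :=
  3 ^ d * (2 ^ β / (Real.pi ^ (β / 2) / Real.Gamma (β / 2 + 1)))

lemma dyadicCoverConst_pos (d : ℕ) {β : ℝ} (hβ : 0 < β) : 0 < dyadicCoverConst d β :=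
  mul_pos (by positivity) (div_pos (by positivity) (unitBallConst_pos hβ))

lemma exists_cube_cover {β : ℝ} (hβ : 0 < β) {E : Set (EuclideanSpace ℝ (Fin d))}
    (c : ℕ → EuclideanSpace ℝ (Fin d)) (r : ℕ → ℝ≥0) (hE : E ⊆ ⋃ i, Metric.ball (c i) (r i)) :
    ∃ (n : {i // 0 < r i} × (Fin d → Fin 3) → ℤ)
      (z : {i // 0 < r i} × (Fin d → Fin 3) → EuclideanSpace ℝ (Fin d)),
      E ⊆ ⋃ i, (hD.cube (n i) (z i)).toSet ∧
      ∑' i, twoPow (n i * β) ≤ ENNReal.ofReal (dyadicCoverConst d β) * ∑' i, ballCost β (r i) := by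
  -- Balls of radius `0` are empty and have no comparable power of two, hence the index type `{i //
  -- 0 < r i}`.
  have hk : ∀ i : {i // 0 < r i}, ∃ k : ℤ, (r i : ℝ) ≤ 2 ^ k ∧ (2 : ℝ) ^ k ≤ 2 * r i := by
    intro i
    obtain ⟨k, h1, h2⟩ := exists_mem_Ico_zpow (NNReal.coe_pos.2 i.2) one_lt_two
    refine ⟨k + 1, h2.le, ?_⟩
    rw [zpow_add_one₀ two_ne_zero]
    linarith
  choose k hk1 hk2 using hk
  refine ⟨fun i => k i.1, fun i => WithLp.toLp 2 fun j => c i.1 j + 2 ^ k i.1 *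
    ((i.2 j : ℕ) - 1 : ℝ), fun y hy => ?_, ?_⟩
  · obtain ⟨i, hi⟩ := Set.mem_iUnion.1 (hE hy)
    have hpos : 0 < r i := NNReal.coe_pos.1 (Metric.pos_of_mem_ball hi)
    obtain ⟨v, hv⟩ := Set.mem_iUnion.1 (hD.ball_subset_iUnion_cube (c i) (hk1 ⟨i, hpos⟩) hi)
    exact Set.mem_iUnion.2 ⟨(⟨i, hpos⟩, v), hv⟩
  · have hω := unitBallConst_pos hβ
    have hcost : ∀ i : {i // 0 < r i}, twoPow (k i * β) ≤
        ENNReal.ofReal (2 ^ β / (Real.pi ^ (β / 2) / Real.Gamma (β / 2 + 1))) *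
          ballCost β (r i) := by
      intro i
      rw [← ofReal_two_zpow_rpow, ballCost, ← ENNReal.ofReal_mul (by positivity)]
      refine ENNReal.ofReal_le_ofReal ?_
      rw [← mul_assoc, div_mul_cancel₀ _ hω.ne', ← Real.mul_rpow two_pos.le (r i).coe_nonneg]
      exact Real.rpow_le_rpow (by positivity) (hk2 i) hβ.le
    rw [ENNReal.tsum_prod']
    calc ∑' (i : {i // 0 < r i}) (_v : Fin d → Fin 3), twoPow (k i * β)
        = ∑' i : {i // 0 < r i}, 3 ^ d * twoPow (k i * β) := by
          refine tsum_congr fun i => ?_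
          rw [tsum_fintype]; simp
      _ ≤ ∑' i : {i // 0 < r i}, ENNReal.ofReal (dyadicCoverConst d β) * ballCost β (r i) := by
          refine ENNReal.tsum_le_tsum fun i => ?_
          rw [dyadicCoverConst, ENNReal.ofReal_mul (by positivity), mul_assoc,
            ENNReal.ofReal_pow (by norm_num), ENNReal.ofReal_ofNat]
          gcongr
          exact hcost i
      _ ≤ _ := by
          rw [ENNReal.tsum_mul_left]
          gcongr
          exact ENNReal.tsum_comp_le_tsum_of_injective Subtype.val_injective _

/-- The good-`λ` inequality for the dyadic potential and the Hausdorff content. -/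
lemma hausdorffContent_goodLambda (hd : 0 < d) {α β : ℝ} (hβ0 : 0 < β)
    (hβ : (d : ℝ) - α < β) (hβd : β ≤ d) (μ : Measure (EuclideanSpace ℝ (Fin d)))
    {F : Set (EuclideanSpace ℝ (Fin d))} {t lam : ℝ≥0∞} (ht0 : t ≠ 0) (ht : t ≠ ⊤)
    (hF : ∀ x ∈ F, ∀ k, fractionalAverage α μ (hD.cube k x) ≤ t) (hlam : lam ≠ ⊤) {m : ℕ}
    (hm : m * (decayStep (β - (d - α)) * t) ≤ lam) :
    hausdorffContent β {x | x ∈ F ∧ 2 * lam < dyadicRieszPotential D α μ x} ≤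
      ENNReal.ofReal (2 * cubeContentConst d β * dyadicCoverConst d β) * 2⁻¹ ^ m *
        hausdorffContent β {x | lam < dyadicRieszPotential D α μ x} := by
  have hC := cubeContentConst_pos d hβ0
  have hK := dyadicCoverConst_pos d hβ0
  have hne : ENNReal.ofReal (2 * cubeContentConst d β * dyadicCoverConst d β) * 2⁻¹ ^ m ≠ 0 :=
    mul_ne_zero (by simpa using by positivity) (by simp)
  have hnt : ENNReal.ofReal (2 * cubeContentConst d β * dyadicCoverConst d β) * 2⁻¹ ^ m ≠ ⊤ :=
    ENNReal.mul_ne_top ENNReal.ofReal_ne_top (by simp)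
  -- With the constant moved to the left, the right side is a bare infimum over covers and one cover
  -- can be treated at a time.
  rw [← ENNReal.div_le_iff' hne hnt]
  refine le_iInf₂ fun c r => le_iInf fun hcr => ?_
  rw [ENNReal.div_le_iff' hne hnt]
  change _ ≤ _ * ∑' i, ballCost β (r i)
  obtain ⟨n, z, hnz, hW⟩ := hD.exists_cube_cover hβ0 c r hcr
  by_cases htop : ∑' i, ballCost β (r i) = ⊤
  · rw [htop, ENNReal.mul_top hne]
    exact le_top
  refine (hD.hausdorffContent_goodLambda_of_cover hd hβ0 hβ hβd μ ht0 ht hF hlam hm n z hnz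
    (ne_top_of_le_ne_top (ENNReal.mul_ne_top ENNReal.ofReal_ne_top htop) hW)).trans ?_
  calc _ ≤ 2 * (ENNReal.ofReal (cubeContentConst d β) * 2⁻¹ ^ m *
        (ENNReal.ofReal (dyadicCoverConst d β) * ∑' i, ballCost β (r i))) := by gcongr
    _ = _ := by
      rw [ENNReal.ofReal_mul (by positivity), ENNReal.ofReal_mul (by positivity),
        ENNReal.ofReal_ofNat]
      ring

end IsDyadicGrid

/-! ### Shifted grids and the one-third trick. -/

section shiftedGrid

variable {d : ℕ}

/-- The cube `2 ^ (-k) ([0,1)^d + m + (-1)^k i)`. -/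
noncomputable def shiftedCube (i : Fin d → ℝ) (k : ℤ) (m : Fin d → ℤ) : AxisCube d where
  corner := WithLp.toLp 2 fun j => (2 : ℝ) ^ (-k) * ((m j : ℝ) + (-1 : ℝ) ^ k * i j)
  side := (2 : ℝ) ^ (-k)
  side_pos := by positivity

/-- The coordinates of the cube of side `2 ^ (-k)` of the shifted grid that contains `x`. -/
noncomputable def shiftedIndex (i : Fin d → ℝ) (k : ℤ) (x : EuclideanSpace ℝ (Fin d)) (j : Fin d) :
    ℤ :=
  ⌊x j * 2 ^ k - (-1) ^ k * i j⌋

lemma mem_shiftedGrid_iff {i : Fin d → ℝ} {Q : AxisCube d} :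
    Q ∈ shiftedGrid i ↔ ∃ k m, Q = shiftedCube i k m := by
  constructor
  · rintro ⟨k, m, hs, hc⟩
    refine ⟨k, m, ?_⟩
    obtain ⟨c, s, hpos⟩ := Q
    simp only at hs hc
    subst hs
    have : c = WithLp.toLp 2 fun j => (2 : ℝ) ^ (-k) * ((m j : ℝ) + (-1 : ℝ) ^ k * i j) :=
      PiLp.ext hc
    subst this
    rfl
  · rintro ⟨k, m, rfl⟩
    exact ⟨k, m, rfl, fun j => rfl⟩

lemma mem_shiftedCube_iff {i : Fin d → ℝ} {k : ℤ} {m : Fin d → ℤ}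
    {x : EuclideanSpace ℝ (Fin d)} :
    x ∈ (shiftedCube i k m).toSet ↔ shiftedIndex i k x = m := by
  rw [funext_iff]
  refine forall_congr' fun j => ?_
  have hpos : (0 : ℝ) < 2 ^ (-k) := by positivity
  have hx : x j = 2 ^ (-k) * (x j * 2 ^ k) := by
    rw [zpow_neg]; field_simp
  have hs : ((2 : ℝ) ^ (-k) * ((m j : ℝ) + (-1 : ℝ) ^ k * i j)) + 2 ^ (-k) =
      2 ^ (-k) * ((m j : ℝ) + 1 + (-1 : ℝ) ^ k * i j) := by ring
  rw [shiftedIndex, Int.floor_eq_iff]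
  change (2 : ℝ) ^ (-k) * ((m j : ℝ) + (-1 : ℝ) ^ k * i j) ≤ x j ∧
    x j < (2 : ℝ) ^ (-k) * ((m j : ℝ) + (-1 : ℝ) ^ k * i j) + 2 ^ (-k) ↔ _
  rw [hs, hx, mul_le_mul_iff_right₀ hpos, mul_lt_mul_iff_right₀ hpos, ← hx]
  constructor <;> rintro ⟨h1, h2⟩ <;> constructor <;> linarith

lemma neg_one_zpow_eq_or (k : ℤ) : (-1 : ℝ) ^ k = 1 ∨ (-1 : ℝ) ^ k = -1 := by
  rcases Int.even_or_odd k with h | h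
  · exact Or.inl h.neg_one_zpow
  · exact Or.inr h.neg_one_zpow

/-- The index at level `l` is the integer part of half of (the index at level `l + 1` minus `e`).
The alternating sign makes the mismatch of the shifts `e = 3 (-1) ^ l i j`, an integer, so finer
cubes nest in coarser ones. -/
lemma shiftedIndex_congr {i : Fin d → ℝ} (hi : ∀ j, ∃ e : ℤ, 3 * i j = e) {k l : ℤ} (hkl : k ≤ l)
    {x y : EuclideanSpace ℝ (Fin d)} (h : shiftedIndex i l x = shiftedIndex i l y) :
    shiftedIndex i k x = shiftedIndex i k y := by
  induction l, hkl using Int.leInduction with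
  | base => exact h
  | succ l _ ih =>
    refine ih (funext fun j => ?_)
    obtain ⟨e, he⟩ : ∃ e : ℤ, 3 * ((-1 : ℝ) ^ l * i j) = e := by
      obtain ⟨e, he⟩ := hi j
      rcases neg_one_zpow_eq_or l with h1 | h1
      · exact ⟨e, by rw [h1, one_mul, he]⟩
      · exact ⟨-e, by rw [h1]; push_cast; linarith⟩
    have key : ∀ z : EuclideanSpace ℝ (Fin d),
        shiftedIndex i l z j = (shiftedIndex i (l + 1) z j - e) / 2 := by
      intro z
      have : z j * 2 ^ l - (-1) ^ l * i j =
          (z j * 2 ^ (l + 1) - (-1) ^ (l + 1) * i j - e) / (2 : ℕ) := by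
        rw [← he, zpow_add_one₀ two_ne_zero, zpow_add_one₀ (by norm_num)]
        push_cast; ring
      rw [shiftedIndex, this, Int.floor_div_natCast, Int.floor_sub_intCast]
      rfl
    rw [key, key, h]

lemma isDyadicGrid_shiftedGrid {i : Fin d → ℝ} (hi : ∀ j, ∃ e : ℤ, 3 * i j = e) :
    IsDyadicGrid (shiftedGrid i) where
  countable := by
    have : shiftedGrid i = Set.range fun p : ℤ × (Fin d → ℤ) => shiftedCube i p.1 p.2 := by
      ext Q
      rw [mem_shiftedGrid_iff, Set.mem_range, Prod.exists]
      simp only [eq_comm]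
    rw [this]
    exact Set.countable_range _
  side_eq := by
    rintro Q ⟨k, m, hs, -⟩
    exact ⟨-k, hs⟩
  nested := by
    have key : ∀ (k l : ℤ) (m n : Fin d → ℤ), k ≤ l →
        ((shiftedCube i k m).toSet ∩ (shiftedCube i l n).toSet).Nonempty →
        (shiftedCube i l n).toSet ⊆ (shiftedCube i k m).toSet := by
      rintro k l m n hkl ⟨z, hz1, hz2⟩ y hy
      rw [mem_shiftedCube_iff] at *
      rw [← hz1]
      exact shiftedIndex_congr hi hkl (hy.trans hz2.symm)
    intro Q hQ P hP
    obtain ⟨k, m, rfl⟩ := mem_shiftedGrid_iff.1 hQ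
    obtain ⟨l, n, rfl⟩ := mem_shiftedGrid_iff.1 hP
    rcases Set.eq_empty_or_nonempty
      ((shiftedCube i k m).toSet ∩ (shiftedCube i l n).toSet) with h | h
    · exact Or.inl h
    · rcases le_total k l with hkl | hkl
      · exact Or.inr (Or.inl (Set.inter_eq_right.2 (key k l m n hkl h)))
      · rw [Set.inter_comm] at h
        exact Or.inr (Or.inr (Set.inter_eq_left.2 (key l k n m hkl h)))
  partition := by
    intro k x
    refine ⟨shiftedCube i (-k) (shiftedIndex i (-k) x),
      ⟨mem_shiftedGrid_iff.2 ⟨_, _, rfl⟩, ?_, mem_shiftedCube_iff.2 rfl⟩, ?_⟩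
    · simp [shiftedCube]
    · rintro Q ⟨hQ, hs, hx⟩
      obtain ⟨l, m, rfl⟩ := mem_shiftedGrid_iff.1 hQ
      have hl : -l = k := zpow_right_injective₀ (a := (2 : ℝ)) (by norm_num) (by norm_num) hs
      obtain rfl : l = -k := by omega
      rw [mem_shiftedCube_iff.1 hx]

lemma three_mul_mem_thirdShifts {i : Fin d → ℝ} (hi : i ∈ thirdShifts d) (j : Fin d) :
    ∃ e : ℤ, 3 * i j = e := by
  have := Fintype.mem_piFinset.1 hi j
  simp only [Finset.mem_insert, Finset.mem_singleton] at this
  rcases this with h | h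
  · exact ⟨0, by simp [h]⟩
  · exact ⟨1, by simp [h]⟩

lemma card_thirdShifts (d : ℕ) : (thirdShifts d).card = 2 ^ d := by
  rw [thirdShifts, Fintype.card_piFinset]
  simp only [Finset.prod_const, Finset.card_univ, Fintype.card_fin]
  rw [Finset.card_pair (by norm_num)]

/-- If an integer separates `u` and `v`, both lie within `1 / 3` of it, and a translation by `1 / 3`
either way puts them in the same unit interval. -/
lemma floor_eq_or_floor_sub_eq {u v s : ℝ} (h : |u - v| < 1 / 3) (hs : s = 1 ∨ s = -1) :
    ⌊u⌋ = ⌊v⌋ ∨ ⌊u - s * (1 / 3)⌋ = ⌊v - s * (1 / 3)⌋ := by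
  wlog huv : u ≤ v generalizing u v
  · rw [abs_sub_comm] at h
    rcases this h (le_of_not_ge huv) with h | h
    · exact Or.inl h.symm
    · exact Or.inr h.symm
  rw [abs_lt] at h
  rcases (Int.floor_mono huv).eq_or_lt with heq | hlt
  · exact Or.inl heq
  right
  have h1 : u < ⌊v⌋ := Int.floor_lt.1 hlt
  have h2 := Int.floor_le v
  rcases hs with rfl | rfl
  · have hu : ⌊u - 1 * (1 / 3)⌋ = ⌊v⌋ - 1 := by
      rw [Int.floor_eq_iff]; push_cast; constructor <;> linarith
    have hv : ⌊v - 1 * (1 / 3)⌋ = ⌊v⌋ - 1 := by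
      rw [Int.floor_eq_iff]; push_cast; constructor <;> linarith
    rw [hu, hv]
  · have hu : ⌊u - -1 * (1 / 3)⌋ = ⌊v⌋ := by
      rw [Int.floor_eq_iff]; constructor <;> linarith
    have hv : ⌊v - -1 * (1 / 3)⌋ = ⌊v⌋ := by
      rw [Int.floor_eq_iff]; constructor <;> linarith
    rw [hu, hv]

/-- The one-third trick: two points at a distance less than a third of `2 ^ k` share a cube of side
`2 ^ k` of one of the shifted grids. -/
lemma exists_mem_shiftedGrid {x y : EuclideanSpace ℝ (Fin d)} {k : ℤ} (h : 3 * dist x y < 2 ^ k) :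
    ∃ i ∈ thirdShifts d, ∃ Q ∈ shiftedGrid i, Q.side = 2 ^ k ∧ x ∈ Q.toSet ∧ y ∈ Q.toSet := by
  have hj : ∀ j : Fin d, ∃ a ∈ ({0, 1 / 3} : Finset ℝ),
      ⌊x j * 2 ^ (-k) - (-1) ^ (-k) * a⌋ = ⌊y j * 2 ^ (-k) - (-1) ^ (-k) * a⌋ := by
    intro j
    have h1 : |x j - y j| ≤ dist x y := by
      have := PiLp.norm_apply_le (x - y) j
      rwa [← dist_eq_norm] at this
    have h2 : |x j * 2 ^ (-k) - y j * 2 ^ (-k)| < 1 / 3 := by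
      rw [← sub_mul, abs_mul, abs_of_pos (by positivity : (0 : ℝ) < 2 ^ (-k)), zpow_neg,
        ← div_eq_mul_inv, div_lt_iff₀ (by positivity)]
      linarith
    rcases floor_eq_or_floor_sub_eq h2 (neg_one_zpow_eq_or (-k)) with h | h
    · exact ⟨0, by simp, by simpa using h⟩
    · exact ⟨1 / 3, by simp, h⟩
  choose i hi hij using hj
  refine ⟨i, Fintype.mem_piFinset.2 hi, shiftedCube i (-k) (shiftedIndex i (-k) x),
    mem_shiftedGrid_iff.2 ⟨_, _, rfl⟩, by simp [shiftedCube], mem_shiftedCube_iff.2 rfl,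
    mem_shiftedCube_iff.2 (funext fun j => (hij j).symm)⟩

end shiftedGrid

/-! ### Pointwise comparison of Riesz and dyadic potentials. -/

section kernel

variable {d : ℕ}

lemma indicator_fractionalAverage_dirac (α : ℝ) (Q : AxisCube d)
    (x y : EuclideanSpace ℝ (Fin d)) :
    Q.toSet.indicator (fun _ => fractionalAverage α (Measure.dirac y) Q) x =
      Q.toSet.indicator (fun _ =>
        Q.toSet.indicator (fun _ => (ENNReal.ofReal (Q.side ^ ((d : ℝ) - α)))⁻¹) x) y := by
  by_cases hx : x ∈ Q.toSet <;> by_cases hy : y ∈ Q.toSet <;>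
    simp [hx, hy, fractionalAverage, Measure.dirac_apply' _ Q.measurableSet_toSet]

lemma measurable_dyadicRieszPotential_dirac {D : Set (AxisCube d)} (hD : D.Countable) (α : ℝ)
    (x : EuclideanSpace ℝ (Fin d)) :
    Measurable fun y => dyadicRieszPotential D α (Measure.dirac y) x := by
  have := hD.to_subtype
  simp only [dyadicRieszPotential, indicator_fractionalAverage_dirac]
  exact Measurable.tsum fun Q : D => measurable_const.indicator Q.1.measurableSet_toSet

/-- The dyadic Riesz potential is the integral of the potentials of point masses. -/
lemma dyadicRieszPotential_eq_lintegral {D : Set (AxisCube d)} (hD : D.Countable) (α : ℝ)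
    (μ : Measure (EuclideanSpace ℝ (Fin d))) (x : EuclideanSpace ℝ (Fin d)) :
    dyadicRieszPotential D α μ x =
      ∫⁻ y, dyadicRieszPotential D α (Measure.dirac y) x ∂μ := by
  have := hD.to_subtype
  simp only [dyadicRieszPotential, indicator_fractionalAverage_dirac]
  rw [lintegral_tsum fun Q : D =>
    (measurable_const.indicator Q.1.measurableSet_toSet).aemeasurable]
  refine tsum_congr fun Q => ?_
  rw [lintegral_indicator_const Q.1.measurableSet_toSet]
  by_cases hx : x ∈ Q.1.toSet <;> simp [hx, fractionalAverage, div_eq_mul_inv, mul_comm]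

lemma rieszConst_pos {α : ℝ} (hα : 0 < α) (hαd : α < d) : 0 < rieszConst d α := by
  have h1 := Real.Gamma_pos_of_pos (show 0 < α / 2 by linarith)
  have h2 := Real.Gamma_pos_of_pos (show 0 < ((d : ℝ) - α) / 2 by linarith)
  unfold rieszConst
  positivity

lemma twoPow_le_sum_dyadicRieszPotential_dirac (α : ℝ) {x y : EuclideanSpace ℝ (Fin d)} {k : ℤ}
    (h : 3 * dist x y < 2 ^ k) :
    twoPow (k * (α - d)) ≤
      ∑ i ∈ thirdShifts d, dyadicRieszPotential (shiftedGrid i) α (Measure.dirac y) x := by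
  obtain ⟨i, hi, Q, hQ, hs, hx, hy⟩ := exists_mem_shiftedGrid h
  refine le_trans ?_ (Finset.single_le_sum
    (f := fun i => dyadicRieszPotential (shiftedGrid i) α (Measure.dirac y) x)
    (fun _ _ => zero_le) hi)
  refine le_trans (le_of_eq ?_) (ENNReal.le_tsum (⟨Q, hQ⟩ : shiftedGrid i))
  rw [Set.indicator_of_mem hx, fractionalAverage, Measure.dirac_apply_of_mem hy, hs,
    ofReal_two_zpow_rpow, one_div, ← twoPow_neg]
  ring_nf

lemma edist_rpow_eq {x y : EuclideanSpace ℝ (Fin d)} (h : x ≠ y) (s : ℝ) :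
    edist x y ^ s = ENNReal.ofReal (dist x y ^ s) := by
  rw [edist_dist, ENNReal.ofReal_rpow_of_pos (dist_pos.2 h)]

lemma edist_rpow_le_sum {α : ℝ} (hαd : α < d) (x y : EuclideanSpace ℝ (Fin d)) :
    edist x y ^ (α - (d : ℝ)) ≤ ENNReal.ofReal (6 ^ ((d : ℝ) - α)) *
      ∑ i ∈ thirdShifts d, dyadicRieszPotential (shiftedGrid i) α (Measure.dirac y) x := by
  rcases eq_or_ne x y with rfl | hxy
  -- On the diagonal the kernel is infinite, and so is the sum: it exceeds `2 ^ (k (d - α))` for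
  -- every `k`.
  · refine le_top.trans_eq (Eq.symm ?_)
    rw [ENNReal.mul_eq_top]
    refine Or.inl ⟨by simpa using by positivity, ?_⟩
    by_contra hW
    obtain ⟨k, hk⟩ := IsDyadicGrid.exists_lt_twoPow (sub_pos.2 hαd) hW
    refine hk.not_ge (le_trans (le_of_eq ?_)
      (twoPow_le_sum_dyadicRieszPotential_dirac α (k := -k) (by simp; positivity)))
    push_cast; ring_nf
  · have hr := dist_pos.2 hxy
    obtain ⟨k, h1, h2⟩ := exists_mem_Ico_zpow (show 0 < 3 * dist x y by positivity) one_lt_two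
    -- The first power of two above `3 * dist x y` is at most twice that, whence the constant `6`.
    have h3 : (2 : ℝ) ^ (k + 1) ≤ 6 * dist x y := by
      rw [zpow_add_one₀ two_ne_zero]; linarith
    refine le_trans ?_ (mul_le_mul_right (twoPow_le_sum_dyadicRieszPotential_dirac α h2) _)
    rw [edist_rpow_eq hxy, ← ofReal_two_zpow_rpow, ← ENNReal.ofReal_mul (by positivity)]
    refine ENNReal.ofReal_le_ofReal ?_
    calc dist x y ^ (α - d) = 6 ^ ((d : ℝ) - α) * (6 * dist x y) ^ (α - (d : ℝ)) := by
          rw [Real.mul_rpow (by norm_num) hr.le, ← mul_assoc, ← Real.rpow_add (by norm_num)]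
          simp
      _ ≤ _ := by
          gcongr 6 ^ ((d : ℝ) - α) * ?_
          exact Real.rpow_le_rpow_of_nonpos (by positivity) h3 (by linarith)

lemma exists_dominatesRiesz {α : ℝ} (hα : 0 < α) (hαd : α < d) :
    ∃ γ₁ : ℝ, 1 < γ₁ ∧ DominatesRiesz d α γ₁ := by
  have hc := rieszConst_pos hα hαd
  refine ⟨max 2 ((rieszConst d α)⁻¹ * 6 ^ ((d : ℝ) - α)), by simp, fun μ _ x => ?_⟩
  calc rieszPotential α μ x ≤ (ENNReal.ofReal (rieszConst d α))⁻¹ *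
        ∫⁻ y, ENNReal.ofReal (6 ^ ((d : ℝ) - α)) *
          ∑ i ∈ thirdShifts d, dyadicRieszPotential (shiftedGrid i) α (Measure.dirac y) x ∂μ := by
        rw [rieszPotential]
        gcongr with y
        exact edist_rpow_le_sum hαd x y
    _ ≤ ENNReal.ofReal ((rieszConst d α)⁻¹ * 6 ^ ((d : ℝ) - α)) *
        ∑ i ∈ thirdShifts d, dyadicRieszPotential (shiftedGrid i) α μ x := by
        rw [lintegral_const_mul' _ _ ENNReal.ofReal_ne_top, ← mul_assoc,
          ENNReal.ofReal_mul (by positivity), ENNReal.ofReal_inv_of_pos hc]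
        gcongr
        rw [lintegral_finsetSum']
        · refine Finset.sum_le_sum fun i hi => ?_
          rw [dyadicRieszPotential_eq_lintegral (isDyadicGrid_shiftedGrid
            (three_mul_mem_thirdShifts hi)).countable]
        · intro i hi
          exact (measurable_dyadicRieszPotential_dirac (isDyadicGrid_shiftedGrid
            (three_mul_mem_thirdShifts hi)).countable α x).aemeasurable
    _ ≤ _ := by
        gcongr
        exact le_max_right _ _

lemma dyadicRieszPotential_dirac_le {D : Set (AxisCube d)} (hD : IsDyadicGrid D) (hd : 0 < d)
    {α : ℝ} (hαd : α < d) (x y : EuclideanSpace ℝ (Fin d)) :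
    dyadicRieszPotential D α (Measure.dirac y) x ≤
      ENNReal.ofReal ((2 * √d) ^ ((d : ℝ) - α)) * (1 - twoPow (-((d : ℝ) - α)))⁻¹ *
        edist x y ^ (α - (d : ℝ)) := by
  have hsd : 0 < √d := by positivity
  rcases eq_or_ne x y with rfl | hxy
  · refine le_top.trans_eq ?_
    rw [edist_self, ENNReal.zero_rpow_of_neg (by linarith), ENNReal.mul_top]
    refine mul_ne_zero (by simpa using by positivity) (ENNReal.inv_ne_zero.2 ?_)
    exact ne_top_of_le_ne_top ENNReal.one_ne_top tsub_le_self
  · have hr := dist_pos.2 hxy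
    obtain ⟨p, h1, h2⟩ := exists_mem_Ico_zpow (show 0 < dist x y / √d by positivity) one_lt_two
    -- A cube that contains both points has side at least `dist x y / √d`, so levels below `p` do
    -- not contribute.
    have hle : ∀ k, fractionalAverage α (Measure.dirac y) (hD.cube k x) ≤
        if p ≤ k then twoPow (-((d : ℝ) - α) * k) else 0 := by
      intro k
      rw [hD.fractionalAverage_cube, Measure.dirac_apply' _ (AxisCube.measurableSet_toSet _)]
      by_cases hy : y ∈ (hD.cube k x).toSet
      · have h3 := AxisCube.dist_le_of_mem _ (hD.mem_cube k x) hy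
        rw [hD.side_cube, mul_comm, ← div_le_iff₀ hsd] at h3
        have hpk : p ≤ k := (zpow_le_zpow_iff_right₀ one_lt_two).1 (h1.trans h3)
        rw [if_pos hpk, Set.indicator_of_mem hy, Pi.one_apply, one_mul]
        ring_nf; rfl
      · simp [hy]
    rw [hD.dyadicRieszPotential_eq]
    refine (ENNReal.tsum_le_tsum hle).trans ?_
    rw [tsum_ite_ge_twoPow, mul_right_comm]
    gcongr
    have h4 : dist x y ≤ 2 * √d * 2 ^ p := by
      rw [zpow_add_one₀ two_ne_zero, div_lt_iff₀ hsd] at h2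
      linarith
    rw [edist_rpow_eq hxy, mul_comm _ (p : ℝ), ← ofReal_two_zpow_rpow,
      ← ENNReal.ofReal_mul (by positivity)]
    refine ENNReal.ofReal_le_ofReal ?_
    calc ((2 : ℝ) ^ p) ^ (-((d : ℝ) - α))
        = (2 * √d) ^ ((d : ℝ) - α) * (2 * √d * 2 ^ p) ^ (α - (d : ℝ)) := by
          rw [Real.mul_rpow (x := 2 * √d) (y := 2 ^ p) (by positivity) (by positivity), ← mul_assoc,
            ← Real.rpow_add (by positivity)]
          simp
      _ ≤ _ := by
          gcongr (2 * √d) ^ ((d : ℝ) - α) * ?_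
          exact Real.rpow_le_rpow_of_nonpos hr h4 (by linarith)

lemma exists_dominatesDyadicRiesz {α : ℝ} (hα : 0 < α) (hαd : α < d) :
    ∃ γ₂ : ℝ, 1 < γ₂ ∧ DominatesDyadicRiesz d α γ₂ := by
  have hc := rieszConst_pos hα hαd
  have hd : 0 < d := by exact_mod_cast hα.trans hαd
  set K := ENNReal.ofReal ((2 * √d) ^ ((d : ℝ) - α)) * (1 - twoPow (-((d : ℝ) - α)))⁻¹
  have hK : K ≠ ⊤ :=
    ENNReal.mul_ne_top ENNReal.ofReal_ne_top (one_sub_twoPow_inv_ne_top (sub_pos.2 hαd))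
  refine ⟨max 2 (K.toReal * rieszConst d α), by simp, fun D hD μ _ x => ?_⟩
  calc dyadicRieszPotential D α μ x ≤ ∫⁻ y, K * edist x y ^ (α - (d : ℝ)) ∂μ := by
        rw [dyadicRieszPotential_eq_lintegral hD.countable]
        exact lintegral_mono fun y => dyadicRieszPotential_dirac_le hD hd hαd x y
    _ = ENNReal.ofReal (K.toReal * rieszConst d α) * rieszPotential α μ x := by
        rw [lintegral_const_mul' _ _ hK, rieszPotential, ← mul_assoc,
          ENNReal.ofReal_mul ENNReal.toReal_nonneg, ENNReal.ofReal_toReal hK, mul_assoc K,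
          ENNReal.mul_inv_cancel (by simpa using hc) ENNReal.ofReal_ne_top, mul_one]
    _ ≤ _ := by
        gcongr
        exact le_max_right _ _

end kernel

/-! ### Exponential rate and conclusion. -/

lemma inv_two_pow_floor_le {A ε : ℝ} (hA : 0 < A) (hε : 0 < ε) :
    (2⁻¹ : ℝ≥0∞) ^ ⌊1 / (A * ε)⌋₊ ≤ ENNReal.ofReal (2 * Real.exp (-(Real.log 2 / A / ε))) := by
  set m := ⌊1 / (A * ε)⌋₊
  have hm : 1 / (A * ε) < m + 1 := Nat.lt_floor_add_one _
  have h2 : (2⁻¹ : ℝ≥0∞) ^ m = ENNReal.ofReal (2⁻¹ ^ m) := by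
    rw [ENNReal.ofReal_pow (by norm_num), ENNReal.ofReal_inv_of_pos two_pos, ENNReal.ofReal_ofNat]
  rw [h2]
  refine ENNReal.ofReal_le_ofReal ?_
  have hlog : 0 < Real.log 2 := Real.log_pos one_lt_two
  have h3 : (2⁻¹ : ℝ) ^ m = Real.exp (-(m * Real.log 2)) := by
    rw [Real.exp_neg, Real.exp_nat_mul, Real.exp_log two_pos, inv_pow]
  have h4 : 2 * Real.exp (-(Real.log 2 / A / ε)) =
      Real.exp (Real.log 2 - 1 / (A * ε) * Real.log 2) := by
    rw [sub_eq_add_neg, Real.exp_add, Real.exp_log two_pos]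
    congr 2
    field_simp
  rw [h3, h4]
  refine Real.exp_le_exp.2 ?_
  nlinarith

theorem mainTheorem8 (d : ℕ) (α : ℝ) (hα : 0 < α) (hαd : α < d) :
    (∃ γ₁ : ℝ, 1 < γ₁ ∧ DominatesRiesz d α γ₁) ∧
    (∃ γ₂ : ℝ, 1 < γ₂ ∧ DominatesDyadicRiesz d α γ₂) ∧
    ∀ β : ℝ, (d : ℝ) - α < β → β ≤ d →
      ∃ C c : ℝ, 0 < C ∧ 0 < c ∧
        ∀ γ₁ γ₂ : ℝ, 1 < γ₁ → DominatesRiesz d α γ₁ → 1 < γ₂ → DominatesDyadicRiesz d α γ₂ →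
          ∀ (μ : Measure (EuclideanSpace ℝ (Fin d))) [IsLocallyFiniteMeasure μ] (lam ε : ℝ),
            0 < lam → 0 < ε → ε < 1 →
            hausdorffContent β {x | ENNReal.ofReal (2 ^ (d + 1) * γ₁ * lam) < rieszPotential α μ x ∧
                fractionalMaximal α μ x ≤ ENNReal.ofReal (ε * lam)} ≤
              ENNReal.ofReal (C * Real.exp (-(c / ε))) *
                hausdorffContent β {x | ENNReal.ofReal (γ₂⁻¹ * lam) < rieszPotential α μ x} := by
  refine ⟨exists_dominatesRiesz hα hαd, exists_dominatesDyadicRiesz hα hαd, fun β hβ hβd => ?_⟩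
  have hd : 0 < d := by exact_mod_cast hα.trans hαd
  have hβ0 : 0 < β := by linarith
  have hδ : 0 < β - (d - α) := by linarith
  set A := (decayStep (β - (d - α))).toReal
  have hA : 0 < A := ENNReal.toReal_pos (decayStep_ne_zero _) (decayStep_ne_top hδ)
  have hAeq : decayStep (β - (d - α)) = ENNReal.ofReal A :=
    (ENNReal.ofReal_toReal (decayStep_ne_top hδ)).symm
  obtain ⟨K, hKdef⟩ : ∃ K, 2 * cubeContentConst d β * IsDyadicGrid.dyadicCoverConst d β = K :=
    ⟨_, rfl⟩
  have hK : 0 < K := hKdef ▸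
    mul_pos (mul_pos two_pos (cubeContentConst_pos d hβ0)) (IsDyadicGrid.dyadicCoverConst_pos d hβ0)
  -- `2 ^ d` counts the grids, `K` comes from the dyadic inequality, and the last `2` is lost in
  -- rounding `1 / (A * ε)` down.
  refine ⟨2 ^ d * K * 2, Real.log 2 / A, by positivity, div_pos (Real.log_pos one_lt_two) hA, ?_⟩
  intro γ₁ γ₂ hγ₁ hdom₁ hγ₂ hdom₂ μ _ lam ε hlam hε _
  -- The largest number of increments `A * (ε * lam)` that fit into `lam`.
  set m := ⌊1 / (A * ε)⌋₊
  set F := {x | fractionalMaximal α μ x ≤ ENNReal.ofReal (ε * lam)}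
  have hm : m * (decayStep (β - (d - α)) * ENNReal.ofReal (ε * lam)) ≤ ENNReal.ofReal lam := by
    rw [hAeq, ← ENNReal.ofReal_natCast, ← ENNReal.ofReal_mul hA.le,
      ← ENNReal.ofReal_mul (Nat.cast_nonneg _)]
    refine ENNReal.ofReal_le_ofReal ?_
    have h1 : (m : ℝ) ≤ 1 / (A * ε) := Nat.floor_le (by positivity)
    rw [le_div_iff₀ (by positivity)] at h1
    nlinarith
  have hcover : {x | ENNReal.ofReal (2 ^ (d + 1) * γ₁ * lam) < rieszPotential α μ x ∧
      fractionalMaximal α μ x ≤ ENNReal.ofReal (ε * lam)} ⊆ ⋃ i : thirdShifts d,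
        {x | x ∈ F ∧ 2 * ENNReal.ofReal lam <
          dyadicRieszPotential (shiftedGrid i.1) α μ x} := by
    rintro x ⟨hx, hxF⟩
    by_contra hno
    simp only [Set.mem_iUnion, not_exists] at hno
    refine hx.not_ge ((hdom₁ μ x).trans ?_)
    calc ENNReal.ofReal γ₁ * ∑ i ∈ thirdShifts d, dyadicRieszPotential (shiftedGrid i) α μ x
        ≤ ENNReal.ofReal γ₁ * ∑ _i ∈ thirdShifts d, 2 * ENNReal.ofReal lam := by
          gcongr with i hi
          by_contra! h
          exact hno ⟨i, hi⟩ ⟨hxF, h⟩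
      _ = ENNReal.ofReal (2 ^ (d + 1) * γ₁ * lam) := by
          rw [Finset.sum_const, card_thirdShifts, nsmul_eq_mul, ENNReal.ofReal_mul (by positivity),
            ENNReal.ofReal_mul (by positivity), ENNReal.ofReal_pow (by norm_num),
            ENNReal.ofReal_ofNat]
          push_cast; ring
  have hgrid : ∀ i : thirdShifts d, hausdorffContent β {x | x ∈ F ∧ 2 * ENNReal.ofReal lam <
      dyadicRieszPotential (shiftedGrid i.1) α μ x} ≤ ENNReal.ofReal K * 2⁻¹ ^ m *
        hausdorffContent β {x | ENNReal.ofReal (γ₂⁻¹ * lam) < rieszPotential α μ x} := by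
    intro i
    have hD := isDyadicGrid_shiftedGrid (three_mul_mem_thirdShifts i.2)
    refine (hD.hausdorffContent_goodLambda hd hβ0 hβ hβd μ (by simpa using by positivity)
      ENNReal.ofReal_ne_top (fun x hx k => ?_) ENNReal.ofReal_ne_top hm).trans ?_
    · exact (le_iSup₂ (f := fun (Q : AxisCube d) (_ : x ∈ Q.toSet) => fractionalAverage α μ Q)
        _ (hD.mem_cube k x)).trans hx
    · rw [hKdef]
      gcongr
      refine hausdorffContent_mono β fun x hx => ?_
      have h1 : ENNReal.ofReal lam < ENNReal.ofReal γ₂ * rieszPotential α μ x :=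
        lt_of_lt_of_le hx (hdom₂ _ hD μ x)
      have hγ : 0 < γ₂ := by linarith
      change ENNReal.ofReal (γ₂⁻¹ * lam) < rieszPotential α μ x
      rw [ENNReal.ofReal_mul (by positivity), ENNReal.ofReal_inv_of_pos hγ, mul_comm,
        ← div_eq_mul_inv]
      exact ENNReal.div_lt_of_lt_mul' h1
  calc _ ≤ _ := hausdorffContent_mono β hcover
    _ ≤ _ := hausdorffContent_iUnion_le hβ0 _
    _ ≤ ∑' _i : thirdShifts d, ENNReal.ofReal K * 2⁻¹ ^ m *
        hausdorffContent β {x | ENNReal.ofReal (γ₂⁻¹ * lam) < rieszPotential α μ x} :=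
      ENNReal.tsum_le_tsum hgrid
    _ = 2 ^ d * (ENNReal.ofReal K * 2⁻¹ ^ m) *
        hausdorffContent β {x | ENNReal.ofReal (γ₂⁻¹ * lam) < rieszPotential α μ x} := by
      rw [tsum_fintype, Finset.sum_const, Finset.card_univ, Fintype.card_coe, card_thirdShifts,
        nsmul_eq_mul, mul_assoc]
      push_cast; ring
    _ ≤ _ := by
      gcongr
      rw [mul_assoc (2 ^ d * K), ENNReal.ofReal_mul (p := 2 ^ d * K) (by positivity),
        ENNReal.ofReal_mul (p := 2 ^ d) (by positivity), ENNReal.ofReal_pow (by norm_num), ENNReal.ofReal_ofNat,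
        ← mul_assoc]
      gcongr
      exact inv_two_pow_floor_le hA hε
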